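/- Let $d\ge 2$, let $A\subset\mathbb{R}^d$ be compact, and let $B$ be a Borel set with $\overline{B}\subset A^\circ$, with Lebesgue measure $|B|>0$, and Riemann measurable (i.e. bounded with $|\partial B|=0$). Let $X_1,Y_1,X_2,Y_2,\dots$ be independent random vectors, with each $X_i$ uniformly distributed over $A$ and each $Y_i$ uniformly distributed over $B$. Let $(Z_t)_{t\ge 0}$ and $(Z'_t)_{t\ge 0}$ be unit rate Poisson counting processes on the same probability space, with $(Z_t)$ independent of all the $X_i,Y_i$, and $(Z'_t)$ independent of all the $X_i,Y_i$ and $(Z_t)$ jointly. For $n,m,k\in\mathbb{N}$ let $$R_{n,m,k}(B):=\inf\{r>0:\ \#\{i\le n:\|X_i-Y_j\|\le r\}\ge k\ \text{ for all } 1\le j\le m\},\qquad \inf\emptyset:=+\infty,$$ and for $t,u>0$ let $R'_{t,u,k}(B)$ be defined in the same way but with $n$ and $m$ replaced by the random numbers $Z_t$ and $Z'_u$. Let $\theta_d$ be the volume of the Euclidean unit ball in $\mathbb{R}^d$ and $f_0:=1/|A|$. Let $k\in\mathbb{N}=\{1,2,\dots\}$, $\tau>0$ and $\beta\in\mathbb{R}$,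 and let $m:\mathbb{N}\to\mathbb{N}$ satisfy $\tau_n:=m(n)/n\to\tau$ as $n\to\infty$. Then, as $n\to\infty$ through the integers, $$\mathbb{P}\big[n\theta_d f_0R_{n,m(n),k}(B)^d-\log n-(k-1)\log\log n\le\beta\big]=\exp\Big(-\frac{\tau_ne^{-\beta}(k-1)^2\log\log n}{(k-1)!\,\log n}\Big)\exp\Big(-\frac{\tau_ne^{-\beta}}{(k-1)!}\Big)+O\big((\log n)^{-1}\big),$$ and, as $t\to\infty$ through the reals, $$\mathbb{P}\big[t\theta_d f_0R'_{t,\tau t,k}(B)^d-\log t-(k-1)\log\log t\le\beta\big]=\exp\Big(-\frac{\tau e^{-\beta}(k-1)^2\log\log t}{(k-1)!\,\log t}\Big)\exp\Big(-\frac{\tau e^{-\beta}}{(k-1)!}\Big)+O\big((\log t)^{-1}\big).$$ Consequently $n\theta_d f_0R_{n,m(n),k}(B)^d-\log n-(k-1)\log\log n$ (as $n\to\infty$) and $t\theta_d f_0R'_{t,\tau t,k}(B)^d-\log t-(k-1)\log\log t$ (as $t\to\infty$) both converge in distribution to the Gumbel law with location $\log(\tau/(k-1)!)$ and scale $1$,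 i.e. with distribution function $x\mapsto\exp\big(-e^{-(x-\log(\tau/(k-1)!))}\big)$. -/

import Mathlib

open MeasureTheory ProbabilityTheory Filter Topology Asymptotics
open scoped NNReal ENNReal

namespace TwoSample

noncomputable section

/-- `θ_d`, the volume of a (Euclidean) ball of unit radius in `ℝ^d`. -/
def unitBallVolume (d : ℕ) : ℝ :=
  volume.real (Metric.closedBall (0 : EuclideanSpace ℝ (Fin d)) 1)

/-- A bounded set whose topological boundary is Lebesgue-null. -/
def IsRiemannMeasurable {d : ℕ} (D : Set (EuclideanSpace ℝ (Fin d))) : Prop :=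
  Bornology.IsBounded D ∧ volume (frontier D) = 0

open Classical in
/-- The number of the sample points `x 0, …, x (n - 1)` that lie in `D`. -/
def pointCount {E : Type*} (x : ℕ → E) (n : ℕ) (D : Set E) : ℕ :=
  ((Finset.range n).filter (fun i => x i ∈ D)).card

/-- The `k`-coverage threshold: the infimum of the `r > 0` such that every closed ball of radius
`r` about one of `y 0, …, y (m - 1)` contains at least `k` of the points `x 0, …, x (n - 1)`.
The infimum is taken in `[0, ∞]`, so that the infimum of the empty set is `∞`. -/
def coverageThreshold {d : ℕ} (x y : ℕ → EuclideanSpace ℝ (Fin d)) (n m k : ℕ) : ℝ≥0∞ :=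
  sInf (ENNReal.ofReal ''
    {r : ℝ | 0 < r ∧ ∀ j < m, k ≤ pointCount x n (Metric.closedBall (y j) r)})

/-- `Z` is a Poisson counting process of unit rate on `[0, ∞)`. -/
structure IsUnitRatePoissonProcess {Ω : Type*} [MeasurableSpace Ω] (P : Measure Ω)
    (Z : ℝ≥0 → Ω → ℕ) : Prop where
  measurable : ∀ t, Measurable (Z t)
  zero : ∀ᵐ ω ∂P, Z 0 ω = 0
  monotone : ∀ᵐ ω ∂P, Monotone (fun t => Z t ω)
  right_continuous : ∀ᵐ ω ∂P, ∀ t, ContinuousWithinAt (fun s => Z s ω) (Set.Ici t) t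
  indep_increments : HasIndepIncrements Z P
  poisson_increments : ∀ s t : ℝ≥0, s ≤ t →
    HasLaw (fun ω => Z t ω - Z s ω) (poissonMeasure (t - s)) P

/-- The probabilistic framework: `X i` uniform on `A`, `Y i` uniform on `B`, all of these
independent; `Z` and `Z'` are unit rate Poisson processes; `Z` is independent of the samples, and
`Z'` is independent of the samples and `Z` taken together. -/
structure IsTwoSampleModel {d : ℕ} {Ω : Type*} [MeasurableSpace Ω] (P : Measure Ω)
    (A B : Set (EuclideanSpace ℝ (Fin d))) (X Y : ℕ → Ω → EuclideanSpace ℝ (Fin d))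
    (Z Z' : ℝ≥0 → Ω → ℕ) : Prop where
  measurable_X : ∀ i, Measurable (X i)
  measurable_Y : ∀ i, Measurable (Y i)
  uniform_X : ∀ i, pdf.IsUniform (X i) A P volume
  uniform_Y : ∀ i, pdf.IsUniform (Y i) B P volume
  indep_samples : iIndepFun (Sum.elim X Y) P
  poisson_Z : IsUnitRatePoissonProcess P Z
  poisson_Z' : IsUnitRatePoissonProcess P Z'
  indep_Z : IndepFun (fun ω t => Z t ω) (fun ω i => (X i ω, Y i ω)) P
  indep_Z' : IndepFun (fun ω t => Z' t ω)
    (fun ω => ((fun i => (X i ω, Y i ω)), (fun t => Z t ω))) P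

/-- The two-sample `k`-coverage threshold `R_{n,m,k}(B)` of `X_1, …, X_n` and `Y_1, …, Y_m`. -/
def binomialThreshold {d : ℕ} {Ω : Type*} (X Y : ℕ → Ω → EuclideanSpace ℝ (Fin d))
    (n m k : ℕ) (ω : Ω) : ℝ≥0∞ :=
  coverageThreshold (fun i => X i ω) (fun i => Y i ω) n m k

/-- The Poissonized threshold `R'_{t,u,k}(B)`, with `Z_t` points `X_i` and `Z'_u` points `Y_i`. -/
def poissonThreshold {d : ℕ} {Ω : Type*} (X Y : ℕ → Ω → EuclideanSpace ℝ (Fin d))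
    (Z Z' : ℝ≥0 → Ω → ℕ) (t u : ℝ≥0) (k : ℕ) (ω : Ω) : ℝ≥0∞ :=
  coverageThreshold (fun i => X i ω) (fun i => Y i ω) (Z t ω) (Z' u ω) k

/-- `t θ_d f_0 R^d - log t - (k - 1) log log t`, where `f_0 = 1 / |A|`; an extended real number,
equal to `∞` for `R = ∞` (when `t > 0`, `|A| > 0` and `d ≥ 1`). -/
def centred {d : ℕ} (A : Set (EuclideanSpace ℝ (Fin d))) (k : ℕ) (t : ℝ) (R : ℝ≥0∞) : EReal :=
  ((t * unitBallVolume d * (1 / volume.real A) : ℝ) : EReal) * (R : EReal) ^ d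
    - (Real.log t : EReal) - ((((k : ℝ) - 1) * Real.log (Real.log t) : ℝ) : EReal)

/-- `exp (-(τ e^{-β} (k-1)² log log t) / ((k-1)! log t)) * exp (-(τ e^{-β}) / (k-1)!)`. -/
def mainTerm (k : ℕ) (τ β t : ℝ) : ℝ :=
  Real.exp (-(τ * Real.exp (-β) * ((k : ℝ) - 1) ^ 2 * Real.log (Real.log t)
      / ((Nat.factorial (k - 1) : ℝ) * Real.log t)))
    * Real.exp (-(τ * Real.exp (-β) / (Nat.factorial (k - 1) : ℝ)))

/-- The cumulative distribution function of the Gumbel law with location `ξ` and scale `θ`. -/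
def gumbelCDF (ξ θ x : ℝ) : ℝ := Real.exp (-Real.exp (-(x - ξ) / θ))

/-- Convergence in distribution of (extended) real random variables `W i`, along the filter `l`,
to the law on `ℝ` with cumulative distribution function `F`. -/
def TendstoInLaw {Ω ι : Type*} [MeasurableSpace Ω] (P : Measure Ω) (W : ι → Ω → EReal)
    (l : Filter ι) (F : ℝ → ℝ) : Prop :=
  ∀ x : ℝ, ContinuousAt F x → Tendsto (fun i => P.real {ω | W i ω ≤ (x : EReal)}) l (𝓝 (F x))

end

end TwoSample

namespace TwoSample

/-- The shift `f ↦ f (· + 1)`. -/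
def shift : Module.End ℝ (ℕ → ℝ) := LinearMap.funLeft ℝ ℝ (· + 1)

/-- The transition operator of a Bernoulli counter with success probability `p`. -/
def binomialStep (p : ℝ) : Module.End ℝ (ℕ → ℝ) := p • shift + (1 - p) • 1

/-- The expectation of `f` under the binomial law with parameters `n` and `p`. -/
def binomialMean (p : ℝ) (n : ℕ) (f : ℕ → ℝ) : ℝ := (binomialStep p ^ n) f 0

/-- The transition operator of a pair of counters, of which at each step the first increases with
probability `p`, and the second one with probability `q`, but never both of them. -/
def trinomialStep (p q : ℝ) : Module.End ℝ (ℕ × ℕ → ℝ) :=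
  p • LinearMap.funLeft ℝ ℝ (fun x : ℕ × ℕ => (x.1 + 1, x.2))
    + (q • LinearMap.funLeft ℝ ℝ (fun x : ℕ × ℕ => (x.1, x.2 + 1)) + (1 - p - q) • 1)

/-- The expectation of `F` under the trinomial law with parameters `n`, `p` and `q`. -/
def trinomialMean (p q : ℝ) (n : ℕ) (F : ℕ × ℕ → ℝ) : ℝ := (trinomialStep p q ^ n) F (0, 0)

/-- The product function `(a, b) ↦ f a * g b`. -/
def tensor (f g : ℕ → ℝ) : ℕ × ℕ → ℝ := fun x => f x.1 * g x.2

@[simp] lemma shift_apply (f : ℕ → ℝ) (a : ℕ) : shift f a = f (a + 1) := rfl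

lemma shift_pow_apply (n : ℕ) (f : ℕ → ℝ) (a : ℕ) : (shift ^ n) f a = f (a + n) := by
  induction n generalizing f with
  | zero => simp
  | succ n ih => rw [pow_succ, Module.End.mul_apply, ih, shift_apply, add_assoc]

lemma binomialStep_apply (p : ℝ) (f : ℕ → ℝ) (a : ℕ) :
    binomialStep p f a = p * f (a + 1) + (1 - p) * f a := by
  simp [binomialStep]

lemma trinomialStep_apply (p q : ℝ) (F : ℕ × ℕ → ℝ) (x : ℕ × ℕ) :
    trinomialStep p q F x =
      p * F (x.1 + 1, x.2) + (q * F (x.1, x.2 + 1) + (1 - p - q) * F x) := by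
  simp [trinomialStep, LinearMap.funLeft_apply]

lemma trinomialMean_zero (p q : ℝ) (F : ℕ × ℕ → ℝ) : trinomialMean p q 0 F = F (0, 0) := by
  simp [trinomialMean]

lemma trinomialMean_succ (p q : ℝ) (n : ℕ) (F : ℕ × ℕ → ℝ) :
    trinomialMean p q (n + 1) F = trinomialMean p q n (trinomialStep p q F) := by
  rw [trinomialMean, pow_succ, Module.End.mul_apply, trinomialMean]

lemma binomialMean_eq_sum (p : ℝ) (n : ℕ) (f : ℕ → ℝ) :
    binomialMean p n f =
      ∑ x ∈ Finset.HasAntidiagonal.antidiagonal n, (n.choose x.1 : ℝ) * (p ^ x.1 * f x.1 * (1 - p) ^ x.2) := by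
  have hc : Commute (p • shift) ((1 - p) • (1 : Module.End ℝ (ℕ → ℝ))) :=
    ((Commute.one_right shift).smul_left p).smul_right _
  rw [binomialMean, binomialStep, hc.add_pow']
  simp only [LinearMap.sum_apply, Finset.sum_apply]
  refine Finset.sum_congr rfl fun x _ => ?_
  rw [smul_pow, smul_pow, one_pow]
  simp [shift_pow_apply]
  ring

lemma binomialMean_two_inv_pow (p : ℝ) (n : ℕ) :
    binomialMean p n (fun a => (2⁻¹ : ℝ) ^ a) = (1 - p / 2) ^ n := by
  have h1 : binomialStep p (fun a => (2⁻¹ : ℝ) ^ a) = (1 - p / 2) • fun a => (2⁻¹ : ℝ) ^ a := by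
    ext a; rw [binomialStep_apply]; simp only [Pi.smul_apply, smul_eq_mul]; ring
  induction n with
  | zero => simp [binomialMean]
  | succ n ih =>
    rw [binomialMean, pow_succ, Module.End.mul_apply, h1, map_smul, Pi.smul_apply, smul_eq_mul,
      ← binomialMean, ih, pow_succ']

lemma binomialStep_mono {p : ℝ} (h0 : 0 ≤ p) (h1 : p ≤ 1) {f g : ℕ → ℝ} (h : f ≤ g) :
    binomialStep p f ≤ binomialStep p g := by
  intro a
  rw [binomialStep_apply, binomialStep_apply]
  have := mul_le_mul_of_nonneg_left (h (a + 1)) h0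
  have := mul_le_mul_of_nonneg_left (h a) (sub_nonneg.2 h1)
  linarith

lemma binomialMean_mono {p : ℝ} (h0 : 0 ≤ p) (h1 : p ≤ 1) (n : ℕ) {f g : ℕ → ℝ} (h : f ≤ g) :
    binomialMean p n f ≤ binomialMean p n g := by
  induction n generalizing f g with
  | zero => simpa [binomialMean] using h 0
  | succ n ih =>
    rw [binomialMean, binomialMean, pow_succ, Module.End.mul_apply, Module.End.mul_apply]
    exact ih (binomialStep_mono h0 h1 h)

lemma binomialStep_antitone {p : ℝ} (h0 : 0 ≤ p) (h1 : p ≤ 1) {f : ℕ → ℝ} (hf : Antitone f) :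
    Antitone (binomialStep p f) := by
  intro a b hab
  rw [binomialStep_apply, binomialStep_apply]
  have := mul_le_mul_of_nonneg_left (hf (Nat.add_le_add_right hab 1)) h0
  have := mul_le_mul_of_nonneg_left (hf hab) (sub_nonneg.2 h1)
  linarith

lemma trinomialStep_mono {p q : ℝ} (hp : 0 ≤ p) (hq : 0 ≤ q) (hpq : p + q ≤ 1)
    {F G : ℕ × ℕ → ℝ} (h : F ≤ G) : trinomialStep p q F ≤ trinomialStep p q G := by
  intro x
  rw [trinomialStep_apply, trinomialStep_apply]
  have := mul_le_mul_of_nonneg_left (h (x.1 + 1, x.2)) hp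
  have := mul_le_mul_of_nonneg_left (h (x.1, x.2 + 1)) hq
  have := mul_le_mul_of_nonneg_left (h x) (show 0 ≤ 1 - p - q by linarith)
  linarith

lemma trinomialMean_mono {p q : ℝ} (hp : 0 ≤ p) (hq : 0 ≤ q) (hpq : p + q ≤ 1) (n : ℕ)
    {F G : ℕ × ℕ → ℝ} (h : F ≤ G) : trinomialMean p q n F ≤ trinomialMean p q n G := by
  induction n generalizing F G with
  | zero => simpa [trinomialMean_zero] using h _
  | succ n ih =>
    rw [trinomialMean_succ, trinomialMean_succ]
    exact ih (trinomialStep_mono hp hq hpq h)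

/-- The two counters are negatively associated. -/
lemma trinomialMean_tensor_le {p q : ℝ} (hp : 0 ≤ p) (hq : 0 ≤ q) (hpq : p + q ≤ 1) (n : ℕ)
    {f g : ℕ → ℝ} (hf : Antitone f) (hg : Antitone g) :
    trinomialMean p q n (tensor f g) ≤ binomialMean p n f * binomialMean q n g := by
  induction n generalizing f g with
  | zero => simp [trinomialMean_zero, tensor, binomialMean]
  | succ n ih =>
    have hp1 : p ≤ 1 := by linarith
    have hq1 : q ≤ 1 := by linarith
    have key : trinomialStep p q (tensor f g)
        ≤ tensor (binomialStep p f) (binomialStep q g) := by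
      intro x
      simp only [trinomialStep_apply, tensor, binomialStep_apply]
      have h1 : 0 ≤ f x.1 - f (x.1 + 1) := sub_nonneg.2 (hf (Nat.le_succ _))
      have h2 : 0 ≤ g x.2 - g (x.2 + 1) := sub_nonneg.2 (hg (Nat.le_succ _))
      nlinarith [mul_nonneg (mul_nonneg hp hq) (mul_nonneg h1 h2)]
    rw [trinomialMean_succ, binomialMean, binomialMean, pow_succ, pow_succ, Module.End.mul_apply,
      Module.End.mul_apply]
    exact (trinomialMean_mono hp hq hpq n key).trans
      (ih (binomialStep_antitone hp hp1 hf) (binomialStep_antitone hq hq1 hg))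

lemma trinomialMean_tensor_one (p q : ℝ) (n : ℕ) (f : ℕ → ℝ) :
    trinomialMean p q n (tensor f fun _ => 1) = binomialMean p n f := by
  induction n generalizing f with
  | zero => simp [trinomialMean_zero, tensor, binomialMean]
  | succ n ih =>
    rw [trinomialMean_succ, binomialMean, pow_succ, Module.End.mul_apply, ← binomialMean, ← ih]
    congr 1
    ext x
    simp only [trinomialStep_apply, tensor, binomialStep_apply]
    ring

lemma trinomialMean_tensor (p q : ℝ) (n : ℕ) (f g : ℕ → ℝ) :
    trinomialMean p q n (tensor f g) =
      ∑ x ∈ Finset.HasAntidiagonal.antidiagonal n, (n.choose x.1 : ℝ) * (p ^ x.1 * f x.1 *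
        ∑ y ∈ Finset.HasAntidiagonal.antidiagonal x.2,
          (x.2.choose y.1 : ℝ) * (q ^ y.1 * g y.1 * (1 - p - q) ^ y.2)) := by
  set S : Module.End ℝ (ℕ × ℕ → ℝ) := LinearMap.funLeft ℝ ℝ (fun x : ℕ × ℕ => (x.1 + 1, x.2))
  set S' : Module.End ℝ (ℕ × ℕ → ℝ) := LinearMap.funLeft ℝ ℝ (fun x : ℕ × ℕ => (x.1, x.2 + 1))
  have hS : ∀ n (F : ℕ × ℕ → ℝ) x, (S ^ n) F x = F (x.1 + n, x.2) := by
    intro n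
    induction n with
    | zero => simp
    | succ n ih =>
      intro F x
      rw [pow_succ, Module.End.mul_apply, ih]
      simp [S, LinearMap.funLeft_apply, add_assoc]
  have hS' : ∀ n (F : ℕ × ℕ → ℝ) x, (S' ^ n) F x = F (x.1, x.2 + n) := by
    intro n
    induction n with
    | zero => simp
    | succ n ih =>
      intro F x
      rw [pow_succ, Module.End.mul_apply, ih]
      simp [S', LinearMap.funLeft_apply, add_assoc]
  have hSS : Commute S S' := by
    ext F x; simp [S, S', LinearMap.funLeft_apply]
  have h2 : Commute (q • S') ((1 - p - q) • (1 : Module.End ℝ (ℕ × ℕ → ℝ))) :=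
    ((Commute.one_right S').smul_left q).smul_right _
  have h1 : Commute (p • S) (q • S' + (1 - p - q) • (1 : Module.End ℝ (ℕ × ℕ → ℝ))) :=
    ((hSS.smul_left p).smul_right q).add_right
      (((Commute.one_right S).smul_left p).smul_right _)
  rw [trinomialMean, trinomialStep, h1.add_pow']
  simp only [LinearMap.sum_apply, Finset.sum_apply]
  refine Finset.sum_congr rfl fun x _ => ?_
  rw [h2.add_pow', smul_pow]
  simp only [← Nat.cast_smul_eq_nsmul ℝ, LinearMap.smul_apply, Module.End.mul_apply,
    Pi.smul_apply, smul_eq_mul, hS, LinearMap.sum_apply, Finset.sum_apply]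
  rw [mul_assoc (p ^ x.1), Finset.mul_sum (a := f x.1)]
  congr 2
  refine Finset.sum_congr rfl fun y _ => ?_
  rw [smul_pow, smul_pow, one_pow]
  simp [hS', tensor]
  ring

lemma summable_pow_div_factorial_mul {f : ℕ → ℝ} (hf : ∀ a, |f a| ≤ 1) (s : ℝ) :
    Summable fun n => ‖s ^ n / (n.factorial : ℝ) * f n‖ := by
  refine Summable.of_nonneg_of_le (fun _ => norm_nonneg _) (fun n => ?_)
    (NormedSpace.norm_expSeries_div_summable (𝔸 := ℝ) s)
  rw [norm_mul]
  exact mul_le_of_le_one_right (norm_nonneg _) (hf n)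

/-- A Cauchy product for exponential generating functions. -/
lemma summable_and_tsum_egf_mul {u v : ℕ → ℝ}
    (hu : Summable fun n => ‖u n / (n.factorial : ℝ)‖)
    (hv : Summable fun n => ‖v n / (n.factorial : ℝ)‖) :
    (Summable fun n => ‖(∑ x ∈ Finset.HasAntidiagonal.antidiagonal n, (n.choose x.1 : ℝ) * (u x.1 * v x.2))
      / (n.factorial : ℝ)‖) ∧
    ∑' n, (∑ x ∈ Finset.HasAntidiagonal.antidiagonal n, (n.choose x.1 : ℝ) * (u x.1 * v x.2))
      / (n.factorial : ℝ)
      = (∑' n, u n / (n.factorial : ℝ)) * ∑' n, v n / (n.factorial : ℝ) := by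
  have key : (fun n : ℕ => (∑ x ∈ Finset.HasAntidiagonal.antidiagonal n, (n.choose x.1 : ℝ) * (u x.1 * v x.2))
      / (n.factorial : ℝ)) = fun n => ∑ x ∈ Finset.HasAntidiagonal.antidiagonal n,
        (u x.1 / (x.1.factorial : ℝ)) * (v x.2 / (x.2.factorial : ℝ)) := by
    ext n
    rw [Finset.sum_div]
    refine Finset.sum_congr rfl fun x hx => ?_
    obtain rfl := Finset.HasAntidiagonal.mem_antidiagonal.1 hx
    have : ((x.1 + x.2).choose x.1 : ℝ) * x.1.factorial * x.2.factorial
        = (x.1 + x.2).factorial := by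
      rw [← Nat.add_choose_mul_factorial_mul_factorial x.1 x.2, Nat.choose_symm_add]
      push_cast; rfl
    have h1 : (x.1.factorial : ℝ) ≠ 0 := by positivity
    have h2 : (x.2.factorial : ℝ) ≠ 0 := by positivity
    have h3 : ((x.1 + x.2).factorial : ℝ) ≠ 0 := by positivity
    rw [div_mul_div_comm, div_eq_div_iff h3 (mul_ne_zero h1 h2), ← this]
    ring
  rw [tsum_mul_tsum_eq_tsum_sum_antidiagonal_of_summable_norm hu hv]
  refine ⟨?_, by rw [key]⟩
  have h := summable_norm_sum_mul_antidiagonal_of_summable_norm hu hv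
  simp only [congrFun key]
  exact h

lemma tsum_pow_div_factorial (s : ℝ) : ∑' n : ℕ, s ^ n / (n.factorial : ℝ) = Real.exp s := by
  rw [Real.exp_eq_exp_ℝ, NormedSpace.exp_eq_tsum_div]

/-- Poisson thinning: with a Poisson number of steps the two counters are independent Poisson
variables. -/
lemma tsum_poisson_trinomialMean (t p q : ℝ) {f g : ℕ → ℝ} (hf : ∀ a, |f a| ≤ 1)
    (hg : ∀ a, |g a| ≤ 1) :
    ∑' n : ℕ, Real.exp (-t) * t ^ n / (n.factorial : ℝ) * trinomialMean p q n (tensor f g) =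
      (Real.exp (-(t * p)) * ∑' a : ℕ, (t * p) ^ a / (a.factorial : ℝ) * f a) *
      (Real.exp (-(t * q)) * ∑' b : ℕ, (t * q) ^ b / (b.factorial : ℝ) * g b) := by
  have hu : Summable fun n : ℕ => ‖(t * p) ^ n * f n / (n.factorial : ℝ)‖ := by
    simpa only [div_mul_eq_mul_div] using summable_pow_div_factorial_mul hf (t * p)
  have hv : Summable fun n : ℕ => ‖(t * q) ^ n * g n / (n.factorial : ℝ)‖ := by
    simpa only [div_mul_eq_mul_div] using summable_pow_div_factorial_mul hg (t * q)
  have hw : Summable fun n : ℕ => ‖(t * (1 - p - q)) ^ n / (n.factorial : ℝ)‖ :=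
    NormedSpace.norm_expSeries_div_summable (𝔸 := ℝ) _
  obtain ⟨h1, h2⟩ := summable_and_tsum_egf_mul hv hw
  obtain ⟨-, h3⟩ := summable_and_tsum_egf_mul hu h1
  rw [h2, tsum_pow_div_factorial] at h3
  have h4 : ∀ n : ℕ, Real.exp (-t) * t ^ n / (n.factorial : ℝ) * trinomialMean p q n (tensor f g)
      = Real.exp (-t) * ((∑ x ∈ Finset.HasAntidiagonal.antidiagonal n, (n.choose x.1 : ℝ) *
        ((t * p) ^ x.1 * f x.1 * ∑ y ∈ Finset.HasAntidiagonal.antidiagonal x.2, (x.2.choose y.1 : ℝ) *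
          ((t * q) ^ y.1 * g y.1 * (t * (1 - p - q)) ^ y.2))) / (n.factorial : ℝ)) := by
    intro n
    rw [trinomialMean_tensor, mul_div_assoc, mul_assoc, div_mul_eq_mul_div, Finset.mul_sum]
    congr 2
    refine Finset.sum_congr rfl fun x hx => ?_
    obtain rfl := Finset.HasAntidiagonal.mem_antidiagonal.1 hx
    rw [show ∑ y ∈ Finset.HasAntidiagonal.antidiagonal x.2, (x.2.choose y.1 : ℝ) *
          ((t * q) ^ y.1 * g y.1 * (t * (1 - p - q)) ^ y.2) = t ^ x.2 *
          ∑ y ∈ Finset.HasAntidiagonal.antidiagonal x.2,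
          (x.2.choose y.1 : ℝ) * (q ^ y.1 * g y.1 * (1 - p - q) ^ y.2) by
        rw [Finset.mul_sum]
        refine Finset.sum_congr rfl fun y hy => ?_
        rw [← Finset.HasAntidiagonal.mem_antidiagonal.1 hy, mul_pow, mul_pow, pow_add]
        ring]
    rw [mul_pow, pow_add]
    ring
  simp_rw [h4]
  rw [tsum_mul_left, h3, show -t = -(t * p) + -(t * q) + -(t * (1 - p - q)) by ring,
    Real.exp_add, Real.exp_add]
  simp_rw [div_mul_eq_mul_div]
  have : Real.exp (-(t * (1 - p - q))) * Real.exp (t * (1 - p - q)) = 1 := by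
    rw [← Real.exp_add]; simp
  linear_combination (Real.exp (-(t * p)) * (∑' a : ℕ, (t * p) ^ a * f a / (a.factorial : ℝ)) *
      (Real.exp (-(t * q)) * ∑' b : ℕ, (t * q) ^ b * g b / (b.factorial : ℝ))) * this

lemma tsum_poisson_binomialMean (t p : ℝ) {f : ℕ → ℝ} (hf : ∀ a, |f a| ≤ 1) :
    ∑' n : ℕ, Real.exp (-t) * t ^ n / (n.factorial : ℝ) * binomialMean p n f =
      Real.exp (-(t * p)) * ∑' a : ℕ, (t * p) ^ a / (a.factorial : ℝ) * f a := by
  have := tsum_poisson_trinomialMean t p 0 hf (g := fun _ => 1) (by simp)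
  simp_rw [trinomialMean_tensor_one, mul_one] at this
  rw [this, tsum_pow_div_factorial]
  simp

end TwoSample

namespace TwoSample

section Counts

variable {E : Type*}

lemma pointCount_zero (x : ℕ → E) (D : Set E) : pointCount x 0 D = 0 := by
  simp [pointCount]

open Classical in
lemma pointCount_eq_sum (x : ℕ → E) (n : ℕ) (D : Set E) :
    pointCount x n D = ∑ i ∈ Finset.range n, if x i ∈ D then 1 else 0 := by
  rw [pointCount, Finset.card_filter]

open Classical in
lemma pointCount_succ (x : ℕ → E) (n : ℕ) (D : Set E) :
    pointCount x (n + 1) D = pointCount x n D + if x n ∈ D then 1 else 0 := by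
  rw [pointCount_eq_sum, pointCount_eq_sum, Finset.sum_range_succ]

lemma pointCount_le (x : ℕ → E) (n : ℕ) (D : Set E) : pointCount x n D ≤ n := by
  classical
  simpa [pointCount] using Finset.card_filter_le (Finset.range n) (fun i => x i ∈ D)

lemma pointCount_mono (x : ℕ → E) (n : ℕ) {D D' : Set E} (h : D ⊆ D') :
    pointCount x n D ≤ pointCount x n D' := by
  classical
  exact Finset.card_le_card (Finset.monotone_filter_right _ fun i _ hi => h hi)

variable [MeasurableSpace E]

lemma measurable_pointCount_section {F : Type*} [MeasurableSpace F] {S : Set (E × F)}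
    (hS : MeasurableSet S) (n : ℕ) :
    Measurable fun p : (ℕ → E) × F => pointCount p.1 n {e | (e, p.2) ∈ S} := by
  classical
  simp only [pointCount_eq_sum, Set.mem_ofPred_eq]
  refine Finset.measurable_sum _ fun i _ => Measurable.ite ?_ measurable_const measurable_const
  exact (((measurable_pi_apply i).comp measurable_fst).prodMk measurable_snd) hS

lemma measurable_pointCount {D : Set E} (hD : MeasurableSet D) (n : ℕ) :
    Measurable fun x : ℕ → E => pointCount x n D := by
  classical
  simp only [pointCount_eq_sum]
  exact Finset.measurable_sum _ fun i _ =>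
    Measurable.ite (measurable_pi_apply i hD) measurable_const measurable_const

variable {Ω : Type*} [MeasurableSpace Ω] {P : Measure Ω} [IsProbabilityMeasure P]
  {X : ℕ → Ω → E}

lemma integrable_comp_pointCount (hX : ∀ i, Measurable (X i)) {D₁ D₂ : Set E}
    (h₁ : MeasurableSet D₁) (h₂ : MeasurableSet D₂) (n : ℕ) (F : ℕ × ℕ → ℝ) :
    Integrable (fun ω => F (pointCount (X · ω) n D₁, pointCount (X · ω) n D₂)) P := by
  have hm : Measurable fun ω => (X · ω) := measurable_pi_lambda _ hX
  have hF : Measurable F := measurable_of_countable F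
  refine Integrable.of_bound (C := ∑ x ∈ Finset.range (n + 1) ×ˢ Finset.range (n + 1), ‖F x‖)
    (hF.comp (((measurable_pointCount h₁ n).comp hm).prodMk
      ((measurable_pointCount h₂ n).comp hm))).aestronglyMeasurable (ae_of_all _ fun ω => ?_)
  refine Finset.single_le_sum (f := fun x => ‖F x‖) (fun _ _ => norm_nonneg _) ?_
  simp [pointCount_le]

omit [IsProbabilityMeasure P] in
lemma indepFun_pointCount_next (hX : ∀ i, Measurable (X i)) (hi : iIndepFun X P) {D₁ D₂ : Set E}
    (h₁ : MeasurableSet D₁) (h₂ : MeasurableSet D₂) (n : ℕ) :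
    IndepFun (X n) (fun ω => (pointCount (X · ω) n D₁, pointCount (X · ω) n D₂)) P := by
  classical
  have h := hi.indepFun_finset {n} (Finset.range n) (by simp) hX
  have hm : ∀ {D : Set E}, MeasurableSet D → Measurable fun z : Finset.range n → E =>
      ∑ i, if z i ∈ D then (1 : ℕ) else 0 := fun hD =>
    Finset.measurable_sum _ fun i _ =>
      Measurable.ite (measurable_pi_apply i hD) measurable_const measurable_const
  have := h.comp (measurable_pi_apply (⟨n, by simp⟩ : ({n} : Finset ℕ)))
    ((hm h₁).prodMk (hm h₂))
  have hsum : ∀ (D : Set E) ω, pointCount (X · ω) n D =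
      ∑ i : Finset.range n, if X i ω ∈ D then 1 else 0 := fun D ω => by
    rw [pointCount_eq_sum]
    exact (Finset.sum_coe_sort (Finset.range n) fun i => if X i ω ∈ D then 1 else 0).symm
  simp only [hsum]
  exact this

/-- The numbers of sample points in two disjoint sets have a trinomial joint law. -/
lemma integral_pointCount_pair (hX : ∀ i, Measurable (X i)) (hi : iIndepFun X P) {ν : Measure E}
    (hν : ∀ i, P.map (X i) = ν) {D₁ D₂ : Set E} (h₁ : MeasurableSet D₁) (h₂ : MeasurableSet D₂)
    (hd : Disjoint D₁ D₂) (n : ℕ) (F : ℕ × ℕ → ℝ) :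
    ∫ ω, F (pointCount (X · ω) n D₁, pointCount (X · ω) n D₂) ∂P
      = trinomialMean (ν.real D₁) (ν.real D₂) n F := by
  classical
  have : IsProbabilityMeasure ν := hν 0 ▸ Measure.isProbabilityMeasure_map (hX 0).aemeasurable
  induction n generalizing F with
  | zero => simp [trinomialMean_zero, pointCount_zero]
  | succ n ih =>
    have hind := indepFun_pointCount_next hX hi h₁ h₂ n
    have hm : Measurable fun ω => (X · ω) := measurable_pi_lambda _ hX
    have hN : Measurable fun ω => (pointCount (X · ω) n D₁, pointCount (X · ω) n D₂) :=
      ((measurable_pointCount h₁ n).comp hm).prodMk ((measurable_pointCount h₂ n).comp hm)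
    have hterm : ∀ (D : Set E) (_ : MeasurableSet D) (G : ℕ × ℕ → ℝ),
        Integrable (fun ω => D.indicator (fun _ => (1 : ℝ)) (X n ω) *
          G (pointCount (X · ω) n D₁, pointCount (X · ω) n D₂)) P ∧
        ∫ ω, D.indicator (fun _ => (1 : ℝ)) (X n ω) *
          G (pointCount (X · ω) n D₁, pointCount (X · ω) n D₂) ∂P =
        ν.real D * ∫ ω, G (pointCount (X · ω) n D₁, pointCount (X · ω) n D₂) ∂P := by
      intro D hD G
      have hmD : Measurable (D.indicator fun _ => (1 : ℝ)) := measurable_const.indicator hD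
      have hG : Measurable G := measurable_of_countable G
      constructor
      · refine (integrable_comp_pointCount hX h₁ h₂ n G).bdd_mul (c := 1)
          (hmD.comp (hX n)).aestronglyMeasurable (ae_of_all _ fun ω => ?_)
        by_cases h : X n ω ∈ D <;> simp [h]
      · refine ((hind.comp hmD hG).integral_fun_mul_eq_mul_integral
          (hmD.comp (hX n)).aestronglyMeasurable (hG.comp hN).aestronglyMeasurable).trans ?_
        refine congrArg₂ _ ?_ rfl
        rw [← hν n, show (D.indicator (fun _ => (1 : ℝ)) ∘ X n)
          = (X n ⁻¹' D).indicator (fun _ => (1 : ℝ)) from by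
            ext ω; simp [Set.indicator], integral_indicator (hX n hD), map_measureReal_apply (hX n) hD]
        simp
    obtain ⟨i1, e1⟩ := hterm D₁ h₁ (fun x => F (x.1 + 1, x.2))
    obtain ⟨i2, e2⟩ := hterm D₂ h₂ (fun x => F (x.1, x.2 + 1))
    obtain ⟨i3, e3⟩ := hterm (D₁ ∪ D₂)ᶜ (h₁.union h₂).compl F
    have hsplit : ∀ ω, F (pointCount (X · ω) (n + 1) D₁, pointCount (X · ω) (n + 1) D₂) =
        D₁.indicator (fun _ => (1 : ℝ)) (X n ω) *
          F (pointCount (X · ω) n D₁ + 1, pointCount (X · ω) n D₂) +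
        (D₂.indicator (fun _ => (1 : ℝ)) (X n ω) *
          F (pointCount (X · ω) n D₁, pointCount (X · ω) n D₂ + 1) +
        (D₁ ∪ D₂)ᶜ.indicator (fun _ => (1 : ℝ)) (X n ω) *
          F (pointCount (X · ω) n D₁, pointCount (X · ω) n D₂)) := by
      intro ω
      rw [pointCount_succ, pointCount_succ]
      by_cases a : X n ω ∈ D₁
      · have b : X n ω ∉ D₂ := Set.disjoint_left.1 hd a
        simp [a, b]
      · by_cases b : X n ω ∈ D₂ <;> simp [a, b]
    simp_rw [hsplit]
    refine (integral_add i1 (i2.add i3)).trans ?_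
    refine (congrArg _ (integral_add i2 i3)).trans ?_
    rw [e1, e2, e3, ih (fun x => F (x.1 + 1, x.2)), ih (fun x => F (x.1, x.2 + 1)), ih F,
      trinomialMean_succ, probReal_compl_eq_one_sub (h₁.union h₂), measureReal_union hd h₂]
    simp only [trinomialMean, trinomialStep]
    simp only [map_add, map_smul, LinearMap.add_apply, LinearMap.smul_apply, Pi.add_apply,
      Pi.smul_apply, smul_eq_mul, Module.End.one_apply, sub_sub]
    rfl

lemma integral_pointCount (hX : ∀ i, Measurable (X i)) (hi : iIndepFun X P) {ν : Measure E}
    (hν : ∀ i, P.map (X i) = ν) {D : Set E} (h : MeasurableSet D) (n : ℕ) (f : ℕ → ℝ) :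
    ∫ ω, f (pointCount (X · ω) n D) ∂P = binomialMean (ν.real D) n f := by
  have := integral_pointCount_pair hX hi hν h MeasurableSet.empty (Set.disjoint_empty D) n
    (tensor f fun _ => 1)
  rw [trinomialMean_tensor_one] at this
  simpa [tensor] using this

end Counts

section Coverage

variable {E : Type*} [PseudoMetricSpace E] [MeasurableSpace E] [OpensMeasurableSpace E]
  [SecondCountableTopology E]

/-- The `μ`-measure of the set of points which are not covered `k` times by the balls of radius
`r` about `x 0, …, x (n - 1)`. -/
noncomputable def vacancy (μ : Measure E) (k : ℕ) (r : ℝ) (n : ℕ) (x : ℕ → E) : ℝ :=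
  μ.real {y | pointCount x n (Metric.closedBall y r) < k}

lemma measurable_pointCount_closedBall (r : ℝ) (n : ℕ) :
    Measurable fun p : (ℕ → E) × E => pointCount p.1 n (Metric.closedBall p.2 r) :=
  measurable_pointCount_section (S := {p : E × E | dist p.1 p.2 ≤ r})
    (measurableSet_le measurable_dist measurable_const) n

lemma measurableSet_vacant (k : ℕ) (r : ℝ) (n : ℕ) :
    MeasurableSet {p : (ℕ → E) × E | pointCount p.1 n (Metric.closedBall p.2 r) < k} :=
  measurable_pointCount_closedBall r n measurableSet_Iio

lemma measurable_vacancy (μ : Measure E) [IsProbabilityMeasure μ] (k : ℕ) (r : ℝ) (n : ℕ) :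
    Measurable (vacancy μ k r n) :=
  (measurable_measure_prodMk_left (measurableSet_vacant k r n)).ennreal_toReal

omit [OpensMeasurableSpace E] [SecondCountableTopology E] in
lemma vacancy_nonneg (μ : Measure E) (k : ℕ) (r : ℝ) (n : ℕ) (x : ℕ → E) :
    0 ≤ vacancy μ k r n x := measureReal_nonneg

omit [OpensMeasurableSpace E] [SecondCountableTopology E] in
lemma vacancy_le_one (μ : Measure E) [IsProbabilityMeasure μ] (k : ℕ) (r : ℝ) (n : ℕ)
    (x : ℕ → E) : vacancy μ k r n x ≤ 1 := measureReal_le_one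

/-- The points `y 0, …, y (m - 1)` are all covered `k` times. -/
def IsCovered (k : ℕ) (r : ℝ) (n m : ℕ) (x y : ℕ → E) : Prop :=
  ∀ j < m, k ≤ pointCount x n (Metric.closedBall (y j) r)

lemma measurableSet_isCovered (k : ℕ) (r : ℝ) (n m : ℕ) :
    MeasurableSet {p : (ℕ → E) × (ℕ → E) | IsCovered k r n m p.1 p.2} := by
  simp only [IsCovered, Set.ofPred_forall]
  refine MeasurableSet.iInter fun j => MeasurableSet.iInter fun _ => ?_
  exact ((measurable_pointCount_closedBall (E := E) r n).comp
    (measurable_fst.prodMk ((measurable_pi_apply j).comp measurable_snd))) measurableSet_Ici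

variable {Ω : Type*} [MeasurableSpace Ω] {P : Measure Ω} [IsProbabilityMeasure P]
  {X Y : ℕ → Ω → E}

omit [PseudoMetricSpace E] [OpensMeasurableSpace E] [SecondCountableTopology E] in
lemma indepFun_of_iIndepFun_sumElim (hX : ∀ i, Measurable (X i)) (hY : ∀ i, Measurable (Y i))
    (h : iIndepFun (Sum.elim X Y) P) : IndepFun (fun ω => (X · ω)) (fun ω => (Y · ω)) P := by
  classical
  refine IndepFun.process_indepFun_process hX hY fun I J => ?_
  have := h.indepFun_finset (I.map ⟨Sum.inl, Sum.inl_injective⟩)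
    (J.map ⟨Sum.inr, Sum.inr_injective⟩)
    (by rw [Finset.disjoint_left]; simp) (by rintro (i | i); exacts [hX i, hY i])
  exact this.comp
    (φ := fun z (i : I) => z ⟨Sum.inl i.1, by simp⟩)
    (ψ := fun z (j : J) => z ⟨Sum.inr j.1, by simp⟩)
    (measurable_pi_lambda _ fun i => measurable_pi_apply _)
    (measurable_pi_lambda _ fun i => measurable_pi_apply _)

/-- Given the `X`-sample, each of `m` independent `Y`-points is covered with probability
`1 - vacancy`. -/
lemma measureReal_isCovered (hX : ∀ i, Measurable (X i)) (hY : ∀ i, Measurable (Y i))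
    (h : iIndepFun (Sum.elim X Y) P) {μ : Measure E} (hμ : ∀ i, P.map (Y i) = μ)
    (k : ℕ) (r : ℝ) (n m : ℕ) :
    P.real {ω | IsCovered k r n m (X · ω) (Y · ω)} =
      ∫ ω, (1 - vacancy μ k r n (X · ω)) ^ m ∂P := by
  have : IsProbabilityMeasure μ := hμ 0 ▸ Measure.isProbabilityMeasure_map (hY 0).aemeasurable
  have hXm : Measurable fun ω => (X · ω) := measurable_pi_lambda _ hX
  have hYm : Measurable fun ω (j : Fin m) => Y j ω := measurable_pi_lambda _ fun j => hY j
  have hind : IndepFun (fun ω => (X · ω)) (fun ω (j : Fin m) => Y j ω) P :=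
    (indepFun_of_iIndepFun_sumElim hX hY h).comp (φ := id)
      (ψ := fun (z : ℕ → E) (j : Fin m) => z j) measurable_id
      (measurable_pi_lambda _ fun j => measurable_pi_apply _)
  have hYi : iIndepFun (fun j : Fin m => Y j) P :=
    h.precomp (g := fun j : Fin m => Sum.inr (j : ℕ))
      (fun a b hab => Fin.ext (Sum.inr_injective hab))
  have hlaw : P.map (fun ω (j : Fin m) => Y j ω) = Measure.pi fun _ => μ := by
    rw [(iIndepFun_iff_map_fun_eq_pi_map fun j : Fin m => (hY j).aemeasurable).1 hYi]
    simp [hμ]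
  have hjoint := (indepFun_iff_map_prod_eq_prod_map_map hXm.aemeasurable hYm.aemeasurable).1 hind
  set G : Set ((ℕ → E) × (Fin m → E)) :=
    {p | ∀ j, k ≤ pointCount p.1 n (Metric.closedBall (p.2 j) r)} with hG
  have hGm : MeasurableSet G := by
    rw [hG]
    simp only [Set.ofPred_forall]
    refine MeasurableSet.iInter fun j => ?_
    exact ((measurable_pointCount_closedBall (E := E) r n).comp
      (measurable_fst.prodMk ((measurable_pi_apply j).comp measurable_snd))) measurableSet_Ici
  have hset : {ω | IsCovered k r n m (X · ω) (Y · ω)} =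
      (fun ω => ((X · ω), fun j : Fin m => Y j ω)) ⁻¹' G := by
    ext ω
    simp only [IsCovered, hG, Set.mem_ofPred_eq, Set.mem_preimage]
    exact ⟨fun H j => H j j.2, fun H j hj => H ⟨j, hj⟩⟩
  have hsec : ∀ x : ℕ → E, (Measure.pi fun _ : Fin m => μ) (Prod.mk x ⁻¹' G)
      = ENNReal.ofReal ((1 - vacancy μ k r n x) ^ m) := by
    intro x
    have h1 : Prod.mk x ⁻¹' G = Set.univ.pi fun _ : Fin m =>
        {y | pointCount x n (Metric.closedBall y r) < k}ᶜ := by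
      ext z; simp [hG]
    have hms : MeasurableSet {y | pointCount x n (Metric.closedBall y r) < k} :=
      measurable_prodMk_left (measurableSet_vacant k r n)
    rw [h1, Measure.pi_pi, Finset.prod_const, Finset.card_univ, Fintype.card_fin, vacancy,
      ← probReal_compl_eq_one_sub hms, ENNReal.ofReal_pow measureReal_nonneg,
      ofReal_measureReal]
  rw [hset, measureReal_def, ← Measure.map_apply (hXm.prodMk hYm) hGm, hjoint, hlaw,
    Measure.prod_apply hGm]
  simp_rw [hsec]
  have hpos : ∀ x, 0 ≤ (1 - vacancy μ k r n x) ^ m := fun x =>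
    pow_nonneg (sub_nonneg.2 (vacancy_le_one μ k r n x)) m
  have hmeas : Measurable fun x => (1 - vacancy μ k r n x) ^ m :=
    ((measurable_vacancy μ k r n).const_sub 1).pow_const m
  rw [lintegral_map hmeas.ennreal_ofReal hXm,
    integral_eq_lintegral_of_nonneg_ae (ae_of_all _ fun ω => hpos _)
      (hmeas.comp hXm).aestronglyMeasurable]

end Coverage

end TwoSample

namespace TwoSample

section Geometry

variable {E : Type*} [NormedAddCommGroup E] [NormedSpace ℝ E] [FiniteDimensional ℝ E]
  [MeasurableSpace E] [BorelSpace E]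

/-- A ball leaves uncovered a proportion at least `s / (4 r)` of its translate by a vector of
length `s ≤ 2 r`. -/
lemma measureReal_closedBall_mul_dist_le (μ : Measure E) [μ.IsAddHaarMeasure] {r : ℝ} (hr : 0 < r)
    (y y' : E) (h : dist y y' ≤ 2 * r) :
    μ.real (Metric.closedBall y r) * (dist y y' / (4 * r)) ≤
      μ.real (Metric.closedBall y' r \ Metric.closedBall y r) := by
  rcases eq_or_lt_of_le (dist_nonneg (x := y) (y := y')) with h0 | h0
  · rw [← h0]; simp
  set z := y' - y with hz
  have hzn : ‖z‖ = dist y y' := by rw [hz, dist_comm, dist_eq_norm]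
  set s := dist y y'
  set B : ℕ → Set E := fun j => Metric.closedBall (y + (j : ℝ) • z) r with hB
  set m := ⌊2 * r / s⌋₊ + 1 with hm
  have htrans : ∀ j, μ.real (B (j + 1) \ B j)
      = μ.real (Metric.closedBall y' r \ Metric.closedBall y r) := by
    intro j
    have : B (j + 1) \ B j = (fun x => -((j : ℝ) • z) + x) ⁻¹'
        (Metric.closedBall y' r \ Metric.closedBall y r) := by
      ext x
      simp only [hB, Set.mem_sdiff, Metric.mem_closedBall, Set.mem_preimage, dist_eq_norm, hz]
      rw [show x - (y + ((j + 1 : ℕ) : ℝ) • (y' - y)) = -((j : ℝ) • (y' - y)) + x - y' by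
          push_cast; module,
        show x - (y + (j : ℝ) • (y' - y)) = -((j : ℝ) • (y' - y)) + x - y by module]
    rw [this, measureReal_def, measure_preimage_add, measureReal_def]
  have hball : μ.real (B m) = μ.real (Metric.closedBall y r) := by
    simp only [hB, measureReal_def, Measure.addHaar_closedBall_center]
  have hfin : ∀ x : E, μ (Metric.closedBall x r) ≠ ∞ := fun x => measure_closedBall_lt_top.ne
  have hsub : B m ⊆ ⋃ j ∈ Finset.range m, B (j + 1) \ B j := by
    have aux : ∀ l, B l \ B 0 ⊆ ⋃ j ∈ Finset.range l, B (j + 1) \ B j := by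
      intro l
      induction l with
      | zero => simp
      | succ l ih =>
        intro x hx
        rw [Finset.range_add_one, Finset.set_biUnion_insert]
        by_cases hxl : x ∈ B l
        · exact Or.inr (ih ⟨hxl, hx.2⟩)
        · exact Or.inl ⟨hx.1, hxl⟩
    intro x hx
    refine aux m ⟨hx, fun hx0 => ?_⟩
    have h1 : dist (y + (m : ℝ) • z) y ≤ 2 * r := by
      have h2 := dist_triangle_left (y + (m : ℝ) • z) y x
      simp only [hB, Nat.cast_zero, zero_smul, add_zero, Metric.mem_closedBall] at hx hx0
      linarith
    rw [dist_eq_norm, add_sub_cancel_left, norm_smul, hzn, Real.norm_natCast] at h1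
    have h3 := Nat.lt_floor_add_one (2 * r / s)
    rw [div_lt_iff₀ h0] at h3
    simp only [hm, Nat.cast_add, Nat.cast_one] at h1
    linarith
  have hle : μ.real (Metric.closedBall y r)
      ≤ m * μ.real (Metric.closedBall y' r \ Metric.closedBall y r) := by
    calc μ.real (Metric.closedBall y r) = μ.real (B m) := hball.symm
      _ ≤ μ.real (⋃ j ∈ Finset.range m, B (j + 1) \ B j) := by
          refine measureReal_mono hsub ?_
          refine (measure_biUnion_lt_top (Finset.range m).finite_toSet fun j _ => ?_).ne
          exact (measure_mono Set.sdiff_subset).trans_lt measure_closedBall_lt_top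
      _ ≤ ∑ j ∈ Finset.range m, μ.real (B (j + 1) \ B j) := measureReal_biUnion_finset_le _ _
      _ = m * μ.real (Metric.closedBall y' r \ Metric.closedBall y r) := by
          simp [htrans]
  have hms : (m : ℝ) * (s / (4 * r)) ≤ 1 := by
    have h4 := Nat.floor_le (show 0 ≤ 2 * r / s by positivity)
    rw [hm]
    push_cast
    rw [← mul_div_assoc, div_le_one (by positivity)]
    have : (⌊2 * r / s⌋₊ : ℝ) * s ≤ 2 * r := (le_div_iff₀ h0).1 h4
    linarith
  calc μ.real (Metric.closedBall y r) * (s / (4 * r))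
      ≤ m * μ.real (Metric.closedBall y' r \ Metric.closedBall y r) * (s / (4 * r)) := by
        gcongr
    _ = (m * (s / (4 * r))) * μ.real (Metric.closedBall y' r \ Metric.closedBall y r) := by ring
    _ ≤ 1 * μ.real (Metric.closedBall y' r \ Metric.closedBall y r) := by gcongr
    _ = _ := one_mul _

lemma integrable_exp_neg_norm (μ : Measure E) [μ.IsAddHaarMeasure] :
    Integrable (fun x : E => Real.exp (-‖x‖)) μ := by
  set N := Module.finrank ℝ E + 1
  have h := (integrable_one_add_norm (E := E) (μ := μ) (r := (N : ℝ)) (by simp [N])).const_mul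
    ((N.factorial : ℝ) * Real.exp 1)
  refine h.mono' (by fun_prop) (ae_of_all _ fun x => ?_)
  have h1 := Real.pow_div_factorial_le_exp (1 + ‖x‖) (by positivity) N
  rw [div_le_iff₀ (by positivity)] at h1
  rw [Real.norm_of_nonneg (Real.exp_pos _).le, Real.rpow_neg (by positivity), Real.rpow_natCast,
    ← div_eq_mul_inv, le_div_iff₀ (by positivity)]
  calc Real.exp (-‖x‖) * (1 + ‖x‖) ^ N ≤
        Real.exp (-‖x‖) * (Real.exp (1 + ‖x‖) * (N.factorial : ℝ)) := by gcongr
    _ = (N.factorial : ℝ) * (Real.exp (-‖x‖) * Real.exp (1 + ‖x‖)) := by ring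
    _ = _ := by rw [← Real.exp_add]; ring_nf

lemma integrable_exp_neg_mul_dist (μ : Measure E) [μ.IsAddHaarMeasure] {c : ℝ} (hc : 0 < c)
    (y : E) : Integrable (fun x : E => Real.exp (-(c * dist y x))) μ := by
  have h := (((integrable_exp_neg_norm μ).comp_smul hc.ne').comp_sub_right y)
  refine h.congr (ae_of_all _ fun x => ?_)
  simp [norm_smul, abs_of_pos hc, dist_comm y x, dist_eq_norm]

lemma integral_exp_neg_mul_dist (μ : Measure E) [μ.IsAddHaarMeasure] {c : ℝ} (hc : 0 < c)
    (y : E) : ∫ x, Real.exp (-(c * dist y x)) ∂μ =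
      (∫ x, Real.exp (-‖x‖) ∂μ) / c ^ Module.finrank ℝ E := by
  have h := Measure.integral_comp_smul_of_nonneg μ (fun x : E => Real.exp (-‖x‖)) c (hR := hc.le)
  rw [← integral_sub_right_eq_self _ y, smul_eq_mul, inv_mul_eq_div] at h
  rw [← h]
  refine integral_congr_ae (ae_of_all _ fun x => ?_)
  simp [norm_smul, abs_of_pos hc, dist_comm y x, dist_eq_norm]

end Geometry

section SecondMoment

variable {α β : Type*} [MeasurableSpace α] [MeasurableSpace β]

lemma measureReal_prod_eq_integral (Q : Measure α) (μ : Measure β) [IsProbabilityMeasure Q]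
    [IsProbabilityMeasure μ] {T : Set (α × β)} (hT : MeasurableSet T) :
    (Q.prod μ).real T = ∫ a, μ.real {b | (a, b) ∈ T} ∂Q := by
  rw [measureReal_def, Measure.prod_apply hT]
  exact (integral_toReal (measurable_measure_prodMk_left hT).aemeasurable
    (ae_of_all _ fun a => measure_lt_top _ _)).symm

lemma measureReal_prod_eq_integral_symm (Q : Measure α) (μ : Measure β) [IsProbabilityMeasure Q]
    [IsProbabilityMeasure μ] {T : Set (α × β)} (hT : MeasurableSet T) :
    (Q.prod μ).real T = ∫ b, Q.real {a | (a, b) ∈ T} ∂μ := by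
  rw [measureReal_def, Measure.prod_apply_symm hT]
  exact (integral_toReal (measurable_measure_prodMk_right hT).aemeasurable
    (ae_of_all _ fun a => measure_lt_top _ _)).symm

variable (Q : Measure α) (μ : Measure β) [IsProbabilityMeasure Q] [IsProbabilityMeasure μ]
  {S : Set (α × β)}

lemma integral_section_eq (hS : MeasurableSet S) {p : ℝ}
    (hp : ∀ᵐ b ∂μ, Q.real {a | (a, b) ∈ S} = p) : ∫ a, μ.real {b | (a, b) ∈ S} ∂Q = p := by
  rw [← measureReal_prod_eq_integral Q μ hS, measureReal_prod_eq_integral_symm Q μ hS,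
    integral_congr_ae hp]
  simp

/-- A bound for the second moment of the measure of a random set in terms of its two-point
function. -/
lemma integral_section_sq_le (hS : MeasurableSet S) {p G : ℝ} {g : β → β → ℝ}
    (hg : ∀ b, Integrable (g b) μ) (hG : ∀ b, ∫ b', g b b' ∂μ ≤ G)
    (hp : ∀ᵐ b ∂μ, ∀ᵐ b' ∂μ, Q.real {a | (a, b) ∈ S ∧ (a, b') ∈ S} ≤ p ^ 2 + g b b') :
    ∫ a, μ.real {b | (a, b) ∈ S} ^ 2 ∂Q ≤ p ^ 2 + G := by
  set T : Set (α × (β × β)) := {x | (x.1, x.2.1) ∈ S ∧ (x.1, x.2.2) ∈ S} with hT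
  have hTm : MeasurableSet T :=
    (measurable_fst.prodMk (measurable_fst.comp measurable_snd) hS).inter
      (measurable_fst.prodMk (measurable_snd.comp measurable_snd) hS)
  have h1 : ∀ a, μ.real {b | (a, b) ∈ S} ^ 2 = (μ.prod μ).real {z | (a, z) ∈ T} := by
    intro a
    rw [show {z : β × β | (a, z) ∈ T} = {b | (a, b) ∈ S} ×ˢ {b | (a, b) ∈ S} by
      ext z; simp [hT], measureReal_prod_prod, sq]
  have hmeas : Measurable fun z : β × β => Q.real {a | (a, z) ∈ T} :=
    (measurable_measure_prodMk_right hTm).ennreal_toReal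
  have hint : Integrable (fun z : β × β => Q.real {a | (a, z) ∈ T}) (μ.prod μ) :=
    Integrable.of_bound (C := 1) hmeas.aestronglyMeasurable (ae_of_all _ fun z => by
      rw [Real.norm_of_nonneg measureReal_nonneg]; exact measureReal_le_one)
  simp_rw [h1]
  rw [← measureReal_prod_eq_integral Q (μ.prod μ) hTm, measureReal_prod_eq_integral_symm Q _ hTm,
    integral_prod _ hint]
  calc ∫ b, ∫ b', Q.real {a | (a, (b, b')) ∈ T} ∂μ ∂μ
      ≤ ∫ _ : β, (p ^ 2 + G) ∂μ := by
        refine integral_mono_ae hint.integral_prod_left (integrable_const _) ?_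
        filter_upwards [hp] with b hb
        calc ∫ b', Q.real {a | (a, (b, b')) ∈ T} ∂μ ≤ ∫ b', (p ^ 2 + g b b') ∂μ := by
              refine integral_mono_ae ?_ ((integrable_const _).add (hg b)) hb
              exact Integrable.of_bound (C := 1)
                (hmeas.comp measurable_prodMk_left).aestronglyMeasurable
                (ae_of_all _ fun z => by
                  rw [Real.norm_of_nonneg measureReal_nonneg]
                  exact measureReal_le_one)
          _ = p ^ 2 + ∫ b', g b b' ∂μ := by
              rw [integral_add (integrable_const _) (hg b)]; simp
          _ ≤ p ^ 2 + G := by linarith [hG b]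
    _ = p ^ 2 + G := by simp

end SecondMoment

end TwoSample

namespace TwoSample

/-- The indicator function of `{0, …, k - 1}`. -/
def ltInd (k : ℕ) (a : ℕ) : ℝ := if a < k then 1 else 0

lemma ltInd_antitone (k : ℕ) : Antitone (ltInd k) := by
  intro a b hab
  unfold ltInd
  split_ifs with h1 h2 <;> first | omega | norm_num

lemma abs_ltInd_le_one (k a : ℕ) : |ltInd k a| ≤ 1 := by
  unfold ltInd; split_ifs <;> simp

lemma ltInd_le (k a : ℕ) : ltInd k a ≤ 2 ^ k * (2⁻¹ : ℝ) ^ a := by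
  unfold ltInd
  split_ifs with h
  · rw [inv_pow, ← div_eq_mul_inv, one_le_div (by positivity)]
    exact pow_le_pow_right₀ one_le_two h.le
  · positivity

lemma ltInd_mul_ltInd (k a b : ℕ) : ltInd k a * ltInd k b = if a < k ∧ b < k then 1 else 0 := by
  unfold ltInd
  by_cases h : a < k <;> simp [h]

/-- The probability that fewer than `k` of the sample points lie in a set of probability `q`, if
the sample size has law `κ`. -/
noncomputable def vacantProb (κ : Measure ℕ) (k : ℕ) (q : ℝ) : ℝ :=
  ∫ n, binomialMean q n (ltInd k) ∂κ

/-- The properties of the law `κ` of the sample size which the second moment bound depends on: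
the numbers of points in two disjoint sets are negatively associated, and a set of probability
`q` is unlikely to contain fewer than `k` points. -/
structure IsCountLaw (κ : Measure ℕ) (t : ℝ) (k : ℕ) : Prop where
  negAssoc : ∀ p q : ℝ, 0 ≤ p → 0 ≤ q → p + q ≤ 1 →
    ∫ n, trinomialMean p q n (tensor (ltInd k) (ltInd k)) ∂κ ≤ vacantProb κ k p * vacantProb κ k q
  decay : ∀ q : ℝ, 0 ≤ q → q ≤ 1 → vacantProb κ k q ≤ 2 ^ k * Real.exp (-(t * q / 2))

lemma vacantProb_dirac (n k : ℕ) (q : ℝ) :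
    vacantProb (Measure.dirac n) k q = binomialMean q n (ltInd k) := by
  rw [vacantProb, integral_dirac]

lemma isCountLaw_dirac (n k : ℕ) : IsCountLaw (Measure.dirac n) n k where
  negAssoc p q hp hq hpq := by
    rw [integral_dirac, vacantProb_dirac, vacantProb_dirac]
    exact trinomialMean_tensor_le hp hq hpq n (ltInd_antitone k) (ltInd_antitone k)
  decay q h0 h1 := by
    rw [vacantProb_dirac]
    have hle : ltInd k ≤ (2 ^ k : ℝ) • fun a => (2⁻¹ : ℝ) ^ a := fun a => ltInd_le k a
    refine (binomialMean_mono h0 h1 n hle).trans ?_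
    rw [binomialMean, map_smul, Pi.smul_apply, smul_eq_mul, ← binomialMean,
      binomialMean_two_inv_pow]
    gcongr
    have : 1 - q / 2 ≤ Real.exp (-(q / 2)) := Real.one_sub_le_exp_neg _
    calc (1 - q / 2) ^ n ≤ Real.exp (-(q / 2)) ^ n :=
          pow_le_pow_left₀ (by linarith) this n
      _ = _ := by rw [← Real.exp_nat_mul]; ring_nf

lemma vacantProb_poisson (t : ℝ≥0) (k : ℕ) (q : ℝ) :
    vacantProb (poissonMeasure t) k q =
      Real.exp (-(t * q)) * ∑ a ∈ Finset.range k, (t * q : ℝ) ^ a / (a.factorial : ℝ) := by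
  rw [vacantProb, integral_poissonMeasure]
  simp_rw [smul_eq_mul]
  rw [tsum_poisson_binomialMean _ _ (abs_ltInd_le_one k)]
  congr 1
  rw [tsum_eq_sum (s := Finset.range k) fun a ha => by simp_all [ltInd]]
  exact Finset.sum_congr rfl fun a ha => by simp [ltInd, Finset.mem_range.1 ha]

lemma isCountLaw_poisson (t : ℝ≥0) (k : ℕ) : IsCountLaw (poissonMeasure t) t k where
  negAssoc p q _ _ _ := by
    rw [vacantProb, vacantProb, integral_poissonMeasure, integral_poissonMeasure,
      integral_poissonMeasure]
    simp_rw [smul_eq_mul]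
    rw [tsum_poisson_trinomialMean _ _ _ (abs_ltInd_le_one k) (abs_ltInd_le_one k),
      tsum_poisson_binomialMean _ _ (abs_ltInd_le_one k),
      tsum_poisson_binomialMean _ _ (abs_ltInd_le_one k)]
  decay q h0 _ := by
    rw [vacantProb_poisson]
    set l : ℝ := t * q with hl
    have hl0 : 0 ≤ l := by positivity
    have h1 : ∑ a ∈ Finset.range k, l ^ a / (a.factorial : ℝ) ≤ 2 ^ k * Real.exp (l / 2) := by
      calc ∑ a ∈ Finset.range k, l ^ a / (a.factorial : ℝ)
          ≤ ∑ a ∈ Finset.range k, 2 ^ k * ((l / 2) ^ a / (a.factorial : ℝ)) := by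
            refine Finset.sum_le_sum fun a ha => ?_
            rw [div_pow, ← mul_div_assoc]
            gcongr
            rw [mul_div_assoc', le_div_iff₀ (by positivity), mul_comm]
            gcongr
            · norm_num
            · exact (Finset.mem_range.1 ha).le
        _ ≤ _ := by
            rw [← Finset.mul_sum]
            gcongr
            exact Real.sum_le_exp_of_nonneg (by positivity) k
    calc Real.exp (-l) * ∑ a ∈ Finset.range k, l ^ a / (a.factorial : ℝ)
        ≤ Real.exp (-l) * (2 ^ k * Real.exp (l / 2)) := by gcongr
      _ = 2 ^ k * (Real.exp (-l) * Real.exp (l / 2)) := by ring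
      _ = _ := by rw [← Real.exp_add]; ring_nf

section Sampling

variable {E : Type*} [MeasurableSpace E] {Ω : Type*} [MeasurableSpace Ω] {P : Measure Ω}
  [IsProbabilityMeasure P] {X : ℕ → Ω → E}

lemma measureReal_pointCount_lt (hX : ∀ i, Measurable (X i)) (hi : iIndepFun X P)
    {ν : Measure E} (hν : ∀ i, P.map (X i) = ν) {D : Set E} (h : MeasurableSet D) (n k : ℕ) :
    P.real {ω | pointCount (X · ω) n D < k} = binomialMean (ν.real D) n (ltInd k) := by
  have hm : MeasurableSet {ω | pointCount (X · ω) n D < k} :=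
    ((measurable_pointCount h n).comp (measurable_pi_lambda _ hX)) measurableSet_Iio
  rw [← integral_pointCount hX hi hν h, ← integral_indicator_one hm]
  simp [Set.indicator, ltInd]

lemma measureReal_pointCount_lt_and_lt (hX : ∀ i, Measurable (X i)) (hi : iIndepFun X P)
    {ν : Measure E} (hν : ∀ i, P.map (X i) = ν) {D₁ D₂ : Set E} (h₁ : MeasurableSet D₁)
    (h₂ : MeasurableSet D₂) (hd : Disjoint D₁ D₂) (n k : ℕ) :
    P.real {ω | pointCount (X · ω) n D₁ < k ∧ pointCount (X · ω) n D₂ < k} =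
      trinomialMean (ν.real D₁) (ν.real D₂) n (tensor (ltInd k) (ltInd k)) := by
  classical
  have hm : ∀ {D : Set E}, MeasurableSet D → MeasurableSet {ω | pointCount (X · ω) n D < k} :=
    fun hD => ((measurable_pointCount hD n).comp (measurable_pi_lambda _ hX)) measurableSet_Iio
  have hmm : MeasurableSet {ω | pointCount (X · ω) n D₁ < k ∧ pointCount (X · ω) n D₂ < k} :=
    (hm h₁).inter (hm h₂)
  rw [← integral_pointCount_pair hX hi hν h₁ h₂ hd, ← integral_indicator_one hmm]
  simp [Set.indicator, tensor, ltInd_mul_ltInd]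

lemma measurableSet_mixed_pointCount_lt (hX : ∀ i, Measurable (X i)) {D : Set E}
    (hD : MeasurableSet D) (k : ℕ) :
    MeasurableSet {x : ℕ × Ω | pointCount (X · x.2) x.1 D < k} := by
  have : Measurable fun x : ℕ × Ω => pointCount (X · x.2) x.1 D :=
    measurable_from_prod_countable_right fun n =>
      (measurable_pointCount hD n).comp (measurable_pi_lambda _ hX)
  exact this measurableSet_Iio

variable {κ : Measure ℕ} [IsProbabilityMeasure κ]

lemma measureReal_mixed_pointCount_lt (hX : ∀ i, Measurable (X i)) (hi : iIndepFun X P)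
    {ν : Measure E} (hν : ∀ i, P.map (X i) = ν) {D : Set E} (h : MeasurableSet D) (k : ℕ) :
    (κ.prod P).real {x | pointCount (X · x.2) x.1 D < k} = vacantProb κ k (ν.real D) := by
  rw [measureReal_prod_eq_integral κ P (measurableSet_mixed_pointCount_lt hX h k)]
  exact integral_congr_ae (ae_of_all _ fun n => measureReal_pointCount_lt hX hi hν h n k)

lemma measureReal_mixed_pointCount_lt_and_lt_le {t : ℝ} {k : ℕ} (hκ : IsCountLaw κ t k)
    (hX : ∀ i, Measurable (X i)) (hi : iIndepFun X P)
    {ν : Measure E} (hν : ∀ i, P.map (X i) = ν) {D₁ D₂ : Set E} (h₁ : MeasurableSet D₁)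
    (h₂ : MeasurableSet D₂) (hd : Disjoint D₁ D₂) :
    (κ.prod P).real
        {x | pointCount (X · x.2) x.1 D₁ < k ∧ pointCount (X · x.2) x.1 D₂ < k} ≤
      vacantProb κ k (ν.real D₁) * vacantProb κ k (ν.real D₂) := by
  have : IsProbabilityMeasure ν := hν 0 ▸ Measure.isProbabilityMeasure_map (hX 0).aemeasurable
  have hm := (measurableSet_mixed_pointCount_lt hX h₁ k).inter
    (measurableSet_mixed_pointCount_lt hX h₂ k)
  refine le_trans (le_of_eq ?_) (hκ.negAssoc (ν.real D₁) (ν.real D₂) measureReal_nonneg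
    measureReal_nonneg ?_)
  · refine (measureReal_prod_eq_integral κ P hm).trans ?_
    exact integral_congr_ae (ae_of_all _ fun n =>
      measureReal_pointCount_lt_and_lt hX hi hν h₁ h₂ hd n k)
  · rw [← measureReal_union hd h₂]; exact measureReal_le_one

end Sampling

section Coverage

variable {E : Type*} [PseudoMetricSpace E] [MeasurableSpace E] [OpensMeasurableSpace E]
  [SecondCountableTopology E] {Ω : Type*} [MeasurableSpace Ω] {X : ℕ → Ω → E}

lemma measurable_mixed_vacancy (hX : ∀ i, Measurable (X i))
    (μ : Measure E) [IsProbabilityMeasure μ] (k : ℕ) (r : ℝ) :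
    Measurable fun x : ℕ × Ω => vacancy μ k r x.1 (X · x.2) :=
  measurable_from_prod_countable_right fun n =>
    (measurable_vacancy μ k r n).comp (measurable_pi_lambda _ hX)

lemma measurableSet_mixed_vacant (hX : ∀ i, Measurable (X i)) (k : ℕ) (r : ℝ) :
    MeasurableSet {x : (ℕ × Ω) × E |
      pointCount (X · x.1.2) x.1.1 (Metric.closedBall x.2 r) < k} := by
  have hXm : Measurable fun ω => (X · ω) := measurable_pi_lambda _ hX
  have hg : Measurable fun z : Ω × E => ((X · z.1), z.2) :=
    (hXm.comp measurable_fst).prodMk measurable_snd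
  have h : Measurable fun x : ℕ × (Ω × E) =>
      pointCount (X · x.2.1) x.1 (Metric.closedBall x.2.2 r) := by
    refine measurable_from_prod_countable_right fun n => ?_
    have := (measurable_pointCount_closedBall (E := E) r n).comp hg
    simpa only [Function.comp_def] using this
  have h' : Measurable fun x : (ℕ × Ω) × E => (x.1.1, (x.1.2, x.2)) := by
    fun_prop
  exact (h.comp h') measurableSet_Iio

end Coverage

section Variance

variable {d : ℕ} {Ω : Type*} [MeasurableSpace Ω] {P : Measure Ω} [IsProbabilityMeasure P]
  {A B : Set (EuclideanSpace ℝ (Fin d))} {X : ℕ → Ω → EuclideanSpace ℝ (Fin d)}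
  {κ : Measure ℕ} [IsProbabilityMeasure κ]

/-- The probability content `f₀ θ_d r ^ d` of a ball of radius `r` inside `A`. -/
noncomputable def ballProb (A : Set (EuclideanSpace ℝ (Fin d))) (r : ℝ) : ℝ :=
  unitBallVolume d * r ^ d / volume.real A

lemma volume_real_closedBall {r : ℝ} (hr : 0 ≤ r) (y : EuclideanSpace ℝ (Fin d)) :
    volume.real (Metric.closedBall y r) = unitBallVolume d * r ^ d := by
  rw [Measure.addHaar_real_closedBall' _ _ hr, finrank_euclideanSpace_fin, mul_comm,
    unitBallVolume]

lemma cond_real_of_subset (hA : MeasurableSet A) {D : Set (EuclideanSpace ℝ (Fin d))}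
    (hD : D ⊆ A) : (cond volume A).real D = volume.real D / volume.real A := by
  rw [measureReal_def, cond_apply hA, Set.inter_eq_right.2 hD, ENNReal.toReal_mul,
    ENNReal.toReal_inv, inv_mul_eq_div, measureReal_def, measureReal_def]

lemma integral_cond_exp_neg_mul_dist_le {c : ℝ} (hc : 0 < c)
    (y : EuclideanSpace ℝ (Fin d)) :
    Integrable (fun y' => Real.exp (-(c * dist y y'))) (cond volume B) ∧
    ∫ y', Real.exp (-(c * dist y y')) ∂(cond volume B) ≤
      (∫ x : EuclideanSpace ℝ (Fin d), Real.exp (-‖x‖)) / c ^ d / volume.real B := by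
  have hint := integrable_exp_neg_mul_dist (volume : Measure (EuclideanSpace ℝ (Fin d))) hc y
  by_cases h0 : volume B = 0
  · rw [cond_eq_zero_of_meas_eq_zero h0]
    simp only [integrable_zero_measure, integral_zero_measure, true_and]
    positivity
  constructor
  · exact hint.restrict.smul_measure (ENNReal.inv_ne_top.2 h0)
  · rw [ProbabilityTheory.cond, integral_smul_measure, smul_eq_mul, ENNReal.toReal_inv, inv_mul_eq_div,
      ← measureReal_def]
    gcongr
    refine (setIntegral_le_integral hint (ae_of_all _ fun _ => (Real.exp_pos _).le)).trans_eq ?_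
    rw [integral_exp_neg_mul_dist _ hc, finrank_euclideanSpace_fin]

theorem vacancy_moments (hA : IsCompact A) (hB : MeasurableSet B) (hBpos : 0 < volume B)
    (hX : ∀ i, Measurable (X i)) (hi : iIndepFun X P) (hν : ∀ i, P.map (X i) = cond volume A)
    {t : ℝ} (ht : 0 < t) {k : ℕ} (hκ : IsCountLaw κ t k) {r : ℝ} (hr : 0 < r)
    (hball : ∀ y ∈ B, Metric.closedBall y r ⊆ A) :
    ∫ x, vacancy (cond volume B) k r x.1 (X · x.2) ∂(κ.prod P) = vacantProb κ k (ballProb A r) ∧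
    ∫ x, vacancy (cond volume B) k r x.1 (X · x.2) ^ 2 ∂(κ.prod P) ≤
      vacantProb κ k (ballProb A r) ^ 2 +
        vacantProb κ k (ballProb A r) * (2 ^ k * ((∫ x : EuclideanSpace ℝ (Fin d),
          Real.exp (-‖x‖)) / (t * ballProb A r / (8 * r)) ^ d / volume.real B)) := by
  have hBA : B ⊆ A := fun y hy => hball y hy (Metric.mem_closedBall_self hr.le)
  have hAfin : volume A ≠ ∞ := hA.measure_lt_top.ne
  have hBfin : volume B ≠ ∞ := measure_ne_top_of_subset hBA hAfin
  have hAm : MeasurableSet A := hA.measurableSet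
  have hApos : 0 < volume A := hBpos.trans_le (measure_mono hBA)
  have hAr : 0 < volume.real A := ENNReal.toReal_pos hApos.ne' hAfin
  have : IsProbabilityMeasure (cond volume B) := cond_isProbabilityMeasure_of_finite hBpos.ne' hBfin
  have : IsProbabilityMeasure (cond volume A) := cond_isProbabilityMeasure_of_finite hApos.ne' hAfin
  have hθ : 0 < unitBallVolume d :=
    ENNReal.toReal_pos (Metric.measure_closedBall_pos _ _ one_pos).ne'
      measure_closedBall_lt_top.ne
  have hq : 0 < ballProb A r := by unfold ballProb; positivity
  have hc : 0 < t * ballProb A r / (8 * r) := by positivity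
  set μ : Measure (EuclideanSpace ℝ (Fin d)) := cond volume B
  set ν : Measure (EuclideanSpace ℝ (Fin d)) := cond volume A
  have hνball : ∀ y ∈ B, ν.real (Metric.closedBall y r) = ballProb A r := fun y hy => by
    rw [cond_real_of_subset hAm (hball y hy), volume_real_closedBall hr.le, ballProb]
  set S : Set ((ℕ × Ω) × EuclideanSpace ℝ (Fin d)) :=
    {x | pointCount (X · x.1.2) x.1.1 (Metric.closedBall x.2 r) < k} with hSdef
  have hSm : MeasurableSet S := measurableSet_mixed_vacant hX k r
  have hp0 : 0 ≤ vacantProb κ k (ballProb A r) := by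
    obtain ⟨y, hy⟩ := nonempty_of_measure_ne_zero hBpos.ne'
    rw [← hνball y hy, ← measureReal_mixed_pointCount_lt (κ := κ) hX hi hν
      Metric.isClosed_closedBall.measurableSet k]
    exact measureReal_nonneg
  have hone : ∀ y ∈ B, (κ.prod P).real {x | (x, y) ∈ S} = vacantProb κ k (ballProb A r) :=
    fun y hy => by
      rw [← hνball y hy]
      exact measureReal_mixed_pointCount_lt hX hi hν Metric.isClosed_closedBall.measurableSet k
  have htwo : ∀ y ∈ B, ∀ y' ∈ B, (κ.prod P).real {x | (x, y) ∈ S ∧ (x, y') ∈ S} ≤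
      vacantProb κ k (ballProb A r) ^ 2 + vacantProb κ k (ballProb A r) *
        (2 ^ k * Real.exp (-(t * ballProb A r / (8 * r) * dist y y'))) := by
    intro y hy y' hy'
    set D := Metric.closedBall y' r \ Metric.closedBall y r
    have hDm : MeasurableSet D := Metric.isClosed_closedBall.measurableSet.diff
      Metric.isClosed_closedBall.measurableSet
    have hle : (κ.prod P).real {x | (x, y) ∈ S ∧ (x, y') ∈ S} ≤
        vacantProb κ k (ballProb A r) * vacantProb κ k (ν.real D) := by
      rw [← hνball y hy]
      refine le_trans (measureReal_mono ?_) (measureReal_mixed_pointCount_lt_and_lt_le hκ hX hi hν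
        Metric.isClosed_closedBall.measurableSet hDm Set.disjoint_sdiff_right)
      rintro x ⟨h1, h2⟩
      exact ⟨h1, (pointCount_mono _ _ Set.sdiff_subset).trans_lt h2⟩
    rcases le_or_gt (dist y y') (2 * r) with hdist | hdist
    · have hDq : ballProb A r * (dist y y' / (4 * r)) ≤ ν.real D := by
        rw [cond_real_of_subset hAm (Set.sdiff_subset.trans (hball y' hy')), ballProb,
          ← volume_real_closedBall hr.le y, div_mul_eq_mul_div]
        gcongr
        exact measureReal_closedBall_mul_dist_le volume hr y y' hdist
      have hdec := hκ.decay (ν.real D) measureReal_nonneg measureReal_le_one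
      have hexp : Real.exp (-(t * ν.real D / 2)) ≤
          Real.exp (-(t * ballProb A r / (8 * r) * dist y y')) := by
        refine Real.exp_le_exp.2 (neg_le_neg ?_)
        calc t * ballProb A r / (8 * r) * dist y y'
            = t * (ballProb A r * (dist y y' / (4 * r))) / 2 := by field_simp; ring
          _ ≤ _ := by gcongr
      calc _ ≤ vacantProb κ k (ballProb A r) * vacantProb κ k (ν.real D) := hle
        _ ≤ vacantProb κ k (ballProb A r) *
            (2 ^ k * Real.exp (-(t * ballProb A r / (8 * r) * dist y y'))) := by
            gcongr
            exact hdec.trans (by gcongr)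
        _ ≤ _ := le_add_of_nonneg_left (sq_nonneg _)
    · have hdisj : Disjoint (Metric.closedBall y' r) (Metric.closedBall y r) :=
        Metric.closedBall_disjoint_closedBall (by rw [dist_comm]; linarith)
      have hDe : D = Metric.closedBall y' r := hdisj.sdiff_eq_left
      rw [hDe, hνball y' hy', ← sq] at hle
      exact hle.trans (le_add_of_nonneg_right (by positivity))
  refine ⟨integral_section_eq (κ.prod P) μ hSm
    ((ae_cond_mem hB).mono hone), ?_⟩
  refine integral_section_sq_le (κ.prod P) μ hSm (g := fun y y' => vacantProb κ k (ballProb A r) *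
        (2 ^ k * Real.exp (-(t * ballProb A r / (8 * r) * dist y y')))) (fun y => ?_) (fun y => ?_)
        ?_
  · exact ((integral_cond_exp_neg_mul_dist_le (B := B) hc y).1.const_mul _).const_mul _
  · rw [integral_const_mul, integral_const_mul]
    gcongr
    exact (integral_cond_exp_neg_mul_dist_le (B := B) hc y).2
  · filter_upwards [ae_cond_mem hB] with y hy
    filter_upwards [ae_cond_mem hB] with y' hy'
    exact htwo y hy y' hy'

end Variance

end TwoSample

namespace TwoSample

section BigO

variable {ι : Type*} {l : Filter ι} {f g h : ι → ℝ}

lemma isBigO_mul_sub_one (hf : (fun i => f i - 1) =O[l] g) (hh : (fun i => h i - 1) =O[l] g)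
    (hg : g =O[l] fun _ => (1 : ℝ)) : (fun i => f i * h i - 1) =O[l] g := by
  have h1 : h =O[l] fun _ => (1 : ℝ) := by
    have := (hh.trans hg).add (isBigO_refl (fun _ : ι => (1 : ℝ)) l)
    simpa using this
  have h2 : (fun i => (f i - 1) * h i) =O[l] g := by simpa using hf.mul h1
  exact (h2.add hh).congr_left fun i => by ring

lemma isBigO_pow_sub_one (hf : (fun i => f i - 1) =O[l] g) (hg : g =O[l] fun _ => (1 : ℝ))
    (n : ℕ) : (fun i => f i ^ n - 1) =O[l] g := by
  induction n with
  | zero => simpa using isBigO_zero g l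
  | succ n ih => simpa only [pow_succ] using isBigO_mul_sub_one ih hf hg

lemma isBigO_one_add_pow_sub (hf : f =O[l] fun _ => (1 : ℝ)) (n : ℕ) :
    (fun i => (1 + f i) ^ n - (1 + n * f i)) =O[l] fun i => f i ^ 2 := by
  induction n with
  | zero => simpa using isBigO_zero _ l
  | succ n ih =>
    have h1 : (fun i => 1 + f i) =O[l] fun _ => (1 : ℝ) := (isBigO_refl _ l).add hf
    have h2 : (fun i => ((1 + f i) ^ n - (1 + n * f i)) * (1 + f i)) =O[l] fun i => f i ^ 2 := by
      simpa using ih.mul h1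
    refine (h2.add ((isBigO_refl (fun i => f i ^ 2) l).const_mul_left (n : ℝ))).congr_left
      fun i => ?_
    push_cast
    ring

end BigO

/-- The leading terms of the suitably scaled Poisson probability of having at most `j` points, as
the mean `L + j log L + β` tends to infinity. -/
lemma isBigO_poisson_partial_sum (j : ℕ) (β : ℝ) :
    (fun L : ℝ => (∑ a ∈ Finset.range (j + 1),
        (L + j * Real.log L + β) ^ a / (a.factorial : ℝ)) / L ^ j
      - (1 + (j : ℝ) ^ 2 * Real.log L / L) / (j.factorial : ℝ)) =O[atTop] fun L => L⁻¹ := by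
  have hinv : (fun L : ℝ => L⁻¹) =O[atTop] fun _ => (1 : ℝ) :=
    tendsto_inv_atTop_zero.isBigO_one ℝ
  set ε : ℝ → ℝ := fun L => (j * Real.log L + β) / L with hε
  have hlog2 : (fun L : ℝ => (j * Real.log L + β) ^ 2) =O[atTop] fun L => L := by
    have h1 : (fun L : ℝ => Real.log L ^ 2) =O[atTop] fun L => L :=
      (Real.isLittleO_pow_log_id_atTop (n := 2)).isBigO
    have h2 : (fun L : ℝ => Real.log L) =O[atTop] fun L => L := Real.isLittleO_log_id_atTop.isBigO
    have h3 : (fun _ : ℝ => (1 : ℝ)) =O[atTop] fun L : ℝ => L :=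
      (isLittleO_const_id_atTop (1 : ℝ)).isBigO
    refine (((h1.const_mul_left ((j : ℝ) ^ 2)).add (h2.const_mul_left (2 * j * β))).add
      (h3.const_mul_left (β ^ 2))).congr_left fun L => by ring
  have hε2 : (fun L => ε L ^ 2) =O[atTop] fun L => L⁻¹ := by
    have := hlog2.mul (isBigO_refl (fun L : ℝ => (L ^ 2)⁻¹) atTop)
    refine this.congr' (Eventually.of_forall fun L => by
      simp only [hε]; ring) ?_
    filter_upwards [eventually_gt_atTop 0] with L hL
    field_simp
  have hε1 : ε =O[atTop] fun _ => (1 : ℝ) := by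
    have h := hε2.trans hinv
    refine IsBigO.of_pow (n := 2) two_ne_zero ?_
    refine h.congr (fun L => rfl) (fun L => ?_)
    simp
  have hratio : ∀ᶠ L : ℝ in atTop, (L + j * Real.log L + β) = L * (1 + ε L) := by
    filter_upwards [eventually_gt_atTop 0] with L hL
    simp only [hε]
    field_simp
    ring
  have h1ε : (fun L => 1 + ε L) =O[atTop] fun _ => (1 : ℝ) := (isBigO_refl _ _).add hε1
  have htop : (fun L : ℝ => (L + j * Real.log L + β) ^ j / (j.factorial : ℝ) / L ^ j
      - (1 + (j : ℝ) ^ 2 * Real.log L / L) / (j.factorial : ℝ)) =O[atTop] fun L => L⁻¹ := by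
    have h := ((isBigO_one_add_pow_sub hε1 j).trans hε2).add
      ((isBigO_refl (fun L : ℝ => L⁻¹) atTop).const_mul_left (j * β))
    refine (h.const_mul_left (j.factorial : ℝ)⁻¹).congr' ?_ EventuallyEq.rfl
    filter_upwards [hratio, eventually_gt_atTop 0] with L hL hL0
    rw [hL, mul_pow]
    simp only [hε]
    field_simp
    ring
  have hlow : (fun L : ℝ => ∑ a ∈ Finset.range j,
      (L + j * Real.log L + β) ^ a / (a.factorial : ℝ) / L ^ j) =O[atTop] fun L => L⁻¹ := by
    refine IsBigO.fun_sum fun a ha => ?_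
    obtain ⟨i, rfl⟩ := Nat.exists_eq_add_of_lt (Finset.mem_range.1 ha)
    have hp : (fun L => (1 + ε L) ^ a) =O[atTop] fun _ => (1 : ℝ) := by simpa using h1ε.pow a
    have hi : (fun L : ℝ => L⁻¹ ^ i) =O[atTop] fun _ => (1 : ℝ) := by simpa using hinv.pow i
    have h := ((hp.mul hi).mul (isBigO_refl (fun L : ℝ => L⁻¹) atTop)).const_mul_left
      (a.factorial : ℝ)⁻¹
    refine h.congr' ?_ (Eventually.of_forall fun L => by simp)
    filter_upwards [hratio, eventually_gt_atTop 0] with L hL hL0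
    rw [hL, mul_pow, inv_pow]
    field_simp
    ring
  refine (htop.add hlow).congr_left fun L => ?_
  rw [Finset.sum_range_succ, add_div _ _ (L ^ j), Finset.sum_div]
  ring

/-- The mean number of points in a ball which makes the number of vacant points converge. -/
noncomputable def criticalMean (k : ℕ) (β t : ℝ) : ℝ :=
  Real.log t + ((k : ℝ) - 1) * Real.log (Real.log t) + β

/-- The second order approximation of the mean number of vacant points. -/
noncomputable def meanApprox (k : ℕ) (β t : ℝ) : ℝ :=
  Real.exp (-β) / (Nat.factorial (k - 1) : ℝ) *
    (1 + ((k : ℝ) - 1) ^ 2 * Real.log (Real.log t) / Real.log t)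

lemma mainTerm_eq (k : ℕ) (τ β t : ℝ) :
    mainTerm k τ β t = Real.exp (-(τ * meanApprox k β t)) := by
  rw [mainTerm, ← Real.exp_add, meanApprox]
  congr 1
  rw [mul_comm ((k - 1).factorial : ℝ) (Real.log t), ← div_div]
  ring

/-- The probability that a Poisson variable with mean `l` is less than `k`. -/
noncomputable def poissonLT (k : ℕ) (l : ℝ) : ℝ :=
  Real.exp (-l) * ∑ a ∈ Finset.range k, l ^ a / (a.factorial : ℝ)

lemma isBigO_mul_poissonLT {k : ℕ} (hk : 1 ≤ k) (β : ℝ) :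
    (fun t : ℝ => t * poissonLT k (criticalMean k β t) - meanApprox k β t)
      =O[atTop] fun t => (Real.log t)⁻¹ := by
  obtain ⟨j, rfl⟩ : ∃ j, k = j + 1 := ⟨k - 1, by omega⟩
  have h := ((isBigO_poisson_partial_sum j β).comp_tendsto Real.tendsto_log_atTop).const_mul_left
    (Real.exp (-β))
  refine h.congr' ?_ EventuallyEq.rfl
  filter_upwards [Real.tendsto_log_atTop.eventually_gt_atTop 0, eventually_gt_atTop 0]
    with t hL ht
  have he : Real.exp (-criticalMean (j + 1) β t) =
      t⁻¹ * ((Real.log t ^ j)⁻¹ * Real.exp (-β)) := by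
    rw [criticalMean, show -(Real.log t + (((j + 1 : ℕ) : ℝ) - 1) * Real.log (Real.log t) + β)
      = -Real.log t + (-(j * Real.log (Real.log t)) + -β) by push_cast; ring, Real.exp_add,
      Real.exp_add, Real.exp_neg, Real.exp_log ht, Real.exp_neg, Real.exp_nat_mul,
      Real.exp_log hL]
  rw [poissonLT, he, meanApprox]
  simp only [criticalMean, Function.comp_apply, Nat.cast_add, Nat.cast_one, add_sub_cancel_right,
    Nat.add_sub_cancel]
  field_simp

lemma isBigO_meanApprox (k : ℕ) (β : ℝ) :
    meanApprox k β =O[atTop] fun _ => (1 : ℝ) := by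
  have h1 : (fun L : ℝ => Real.log L / L) =O[atTop] fun _ => (1 : ℝ) :=
    (Real.isLittleO_log_id_atTop.tendsto_div_nhds_zero).isBigO_one ℝ
  have h2 := h1.comp_tendsto Real.tendsto_log_atTop
  have h3 := ((isBigO_refl (fun _ : ℝ => (1 : ℝ)) atTop).add
    (h2.const_mul_left (((k : ℝ) - 1) ^ 2))).const_mul_left
      (Real.exp (-β) / (Nat.factorial (k - 1) : ℝ))
  refine h3.congr_left fun t => ?_
  simp only [meanApprox, Function.comp_apply]
  ring

lemma tendsto_meanApprox (k : ℕ) (β : ℝ) :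
    Tendsto (meanApprox k β) atTop (𝓝 (Real.exp (-β) / (Nat.factorial (k - 1) : ℝ))) := by
  have h1 : Tendsto (fun t : ℝ => Real.log (Real.log t) / Real.log t) atTop (𝓝 0) :=
    Real.isLittleO_log_id_atTop.tendsto_div_nhds_zero.comp Real.tendsto_log_atTop
  have h2 := ((h1.const_mul (((k : ℝ) - 1) ^ 2)).const_add 1).const_mul
    (Real.exp (-β) / (Nat.factorial (k - 1) : ℝ))
  simp only [mul_zero, add_zero, mul_one] at h2
  refine h2.congr fun t => ?_
  simp only [meanApprox]
  ring

lemma isEquivalent_criticalMean (k : ℕ) (β : ℝ) :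
    criticalMean k β ~[atTop] Real.log := by
  have h1 : (fun t : ℝ => Real.log (Real.log t)) =o[atTop] Real.log :=
    Real.isLittleO_log_id_atTop.comp_tendsto Real.tendsto_log_atTop
  have h2 : (fun _ : ℝ => β) =o[atTop] Real.log :=
    (isLittleO_const_id_atTop β).comp_tendsto Real.tendsto_log_atTop
  have h3 := (h1.const_mul_left ((k : ℝ) - 1)).add h2
  refine (h3.congr_left fun t => ?_ : IsEquivalent _ _ _)
  simp only [criticalMean, Pi.sub_apply]
  ring

lemma tendsto_criticalMean (k : ℕ) (β : ℝ) : Tendsto (criticalMean k β) atTop atTop :=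
  (isEquivalent_criticalMean k β).symm.tendsto_atTop Real.tendsto_log_atTop

lemma isBigO_criticalMean_inv (k : ℕ) (β : ℝ) :
    (fun t => (criticalMean k β t)⁻¹) =O[atTop] fun t => (Real.log t)⁻¹ :=
  (isEquivalent_criticalMean k β).inv.isBigO

lemma isBigO_criticalMean_pow_div (k : ℕ) (β : ℝ) (i : ℕ) :
    (fun t => criticalMean k β t ^ i / t) =O[atTop] fun t => (Real.log t)⁻¹ := by
  have h1 : (fun t => criticalMean k β t ^ i / t) =O[atTop] fun t => Real.log t ^ i / t := by
    simp only [div_eq_mul_inv]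
    exact ((isEquivalent_criticalMean k β).isBigO.pow i).mul (isBigO_refl _ _)
  have h2 : (fun t => Real.log t ^ (i + 1) * (t⁻¹ * (Real.log t)⁻¹)) =O[atTop]
      fun t => t * (t⁻¹ * (Real.log t)⁻¹) :=
    (Real.isLittleO_pow_log_id_atTop (n := i + 1)).isBigO.mul (isBigO_refl _ _)
  refine h1.trans (h2.congr' ?_ ?_)
  · filter_upwards [Real.tendsto_log_atTop.eventually_gt_atTop 0] with t hL
    field_simp
    ring
  · filter_upwards [eventually_gt_atTop 0] with t ht
    field_simp

lemma binomialMean_ltInd {n k : ℕ} (hkn : k ≤ n) (p : ℝ) :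
    binomialMean p n (ltInd k) =
      ∑ a ∈ Finset.range k, (n.choose a : ℝ) * (p ^ a * (1 - p) ^ (n - a)) := by
  rw [binomialMean_eq_sum, Finset.Nat.sum_antidiagonal_eq_sum_range_succ_mk,
    ← Finset.sum_subset (Finset.range_mono (hkn.trans n.le_succ))]
  · exact Finset.sum_congr rfl fun a ha => by simp [ltInd, Finset.mem_range.1 ha]
  · intro a _ ha
    simp [ltInd, Finset.mem_range.not.1 ha]

lemma isBigO_inv_log_one :
    (fun n : ℕ => (Real.log n)⁻¹) =O[atTop] fun _ => (1 : ℝ) :=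
  ((tendsto_inv_atTop_zero.comp Real.tendsto_log_atTop).comp
    tendsto_natCast_atTop_atTop).isBigO_one ℝ

lemma isBigO_descFactorial_div_pow (a : ℕ) :
    (fun n : ℕ => (n.descFactorial a : ℝ) / (n : ℝ) ^ a - 1) =O[atTop]
      fun n : ℕ => (Real.log n)⁻¹ := by
  induction a with
  | zero => simpa using isBigO_zero _ _
  | succ a ih =>
    have h1 : (fun n : ℕ => ((n : ℝ) - a) / n - 1) =O[atTop] fun n : ℕ => (Real.log n)⁻¹ := by
      have h2 : (fun n : ℕ => ((n : ℝ))⁻¹) =O[atTop] fun n : ℕ => (Real.log n)⁻¹ := by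
        have := (isBigO_criticalMean_pow_div 0 0 0).comp_tendsto
          (tendsto_natCast_atTop_atTop (R := ℝ))
        simpa [Function.comp_def] using this
      refine (h2.const_mul_left (-(a : ℝ))).congr' ?_ EventuallyEq.rfl
      filter_upwards [eventually_gt_atTop 0] with n hn
      have : (n : ℝ) ≠ 0 := by positivity
      field_simp
      ring
    refine (isBigO_mul_sub_one h1 ih isBigO_inv_log_one).congr' ?_ EventuallyEq.rfl
    filter_upwards [eventually_ge_atTop a] with n hn
    rw [Nat.descFactorial_succ, Nat.cast_mul, Nat.cast_sub hn, pow_succ', mul_div_mul_comm]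

lemma abs_one_sub_pow_mul_exp_sub_one_le {q : ℝ} (h0 : 0 ≤ q) (h1 : q ≤ 1) (n : ℕ) :
    |(1 - q) ^ n * Real.exp (n * q) - 1| ≤ n * q ^ 2 := by
  have e : (1 - q) ^ n * Real.exp (n * q) = ((1 - q) * Real.exp q) ^ n := by
    rw [mul_pow, ← Real.exp_nat_mul]
  have hle : (1 - q) * Real.exp q ≤ 1 := by
    have := mul_le_mul_of_nonneg_right (Real.one_sub_le_exp_neg q) (Real.exp_pos q).le
    rwa [← Real.exp_add, neg_add_cancel, Real.exp_zero] at this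
  have hge : 1 - q ^ 2 ≤ (1 - q) * Real.exp q := by
    nlinarith [mul_le_mul_of_nonneg_left (Real.add_one_le_exp q) (sub_nonneg.2 h1)]
  have hsq : 0 ≤ 1 - q ^ 2 := by nlinarith
  rw [e, abs_le]
  constructor
  · have h2 := one_add_mul_le_pow (a := -q ^ 2) (by linarith) n
    have h3 := pow_le_pow_left₀ hsq hge n
    have : 1 + -q ^ 2 = 1 - q ^ 2 := by ring
    rw [this] at h2
    linarith
  · have h4 : ((1 - q) * Real.exp q) ^ n ≤ 1 := pow_le_one₀ (hsq.trans hge) hle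
    have : 0 ≤ (n : ℝ) * q ^ 2 := by positivity
    linarith

lemma isBigO_binomial_div_poisson (k : ℕ) (β : ℝ) (a : ℕ) :
    (fun n : ℕ => (n.descFactorial a : ℝ) / (n : ℝ) ^ a *
      ((1 - criticalMean k β n / n) ^ n * Real.exp (criticalMean k β n) *
        (1 - criticalMean k β n / n)⁻¹ ^ a) - 1) =O[atTop] fun n : ℕ => (Real.log n)⁻¹ := by
  have hcast := tendsto_natCast_atTop_atTop (R := ℝ)
  have hq : (fun n : ℕ => criticalMean k β n / n) =O[atTop] fun n : ℕ => (Real.log n)⁻¹ := by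
    simpa [Function.comp_def] using (isBigO_criticalMean_pow_div k β 1).comp_tendsto hcast
  have hq2 : (fun n : ℕ => criticalMean k β n ^ 2 / n) =O[atTop] fun n : ℕ => (Real.log n)⁻¹ :=
    (isBigO_criticalMean_pow_div k β 2).comp_tendsto hcast
  have hl0 : Tendsto (fun n : ℕ => (Real.log n)⁻¹) atTop (𝓝 0) :=
    (tendsto_inv_atTop_zero.comp Real.tendsto_log_atTop).comp hcast
  have hq0 : Tendsto (fun n : ℕ => criticalMean k β n / n) atTop (𝓝 0) := hq.trans_tendsto hl0
  have hpos : ∀ᶠ n : ℕ in atTop, 0 < criticalMean k β n :=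
    ((tendsto_criticalMean k β).comp hcast).eventually_gt_atTop 0
  have h2 : (fun n : ℕ => (1 - criticalMean k β n / n) ^ n * Real.exp (criticalMean k β n) - 1)
      =O[atTop] fun n : ℕ => (Real.log n)⁻¹ := by
    refine IsBigO.trans (IsBigO.of_bound 1 ?_) hq2
    filter_upwards [hpos, hq0.eventually_lt_const one_pos, eventually_gt_atTop 0] with n h0 h1 hn
    have hn' : (0 : ℝ) < n := by positivity
    have := abs_one_sub_pow_mul_exp_sub_one_le (div_pos h0 hn').le h1.le n
    rw [mul_div_cancel₀ _ hn'.ne'] at this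
    rw [Real.norm_eq_abs, Real.norm_of_nonneg (by positivity), one_mul]
    refine this.trans_eq ?_
    field_simp
  have h3 : (fun n : ℕ => (1 - criticalMean k β n / n)⁻¹ - 1) =O[atTop]
      fun n : ℕ => (Real.log n)⁻¹ := by
    have h4 : (fun n : ℕ => (1 - criticalMean k β n / n)⁻¹) =O[atTop] fun _ => (1 : ℝ) := by
      have : Tendsto (fun n : ℕ => 1 - criticalMean k β n / n) atTop (𝓝 1) := by
        simpa using hq0.const_sub 1
      exact (this.inv₀ one_ne_zero).isBigO_one ℝ
    refine (hq.mul h4).congr' ?_ (Eventually.of_forall fun n => by simp)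
    filter_upwards [hq0.eventually_lt_const one_pos] with n h1
    have : 1 - criticalMean k β n / n ≠ 0 := by linarith
    field_simp
    ring
  exact isBigO_mul_sub_one (isBigO_descFactorial_div_pow a)
    (isBigO_mul_sub_one h2 (isBigO_pow_sub_one h3 isBigO_inv_log_one a) isBigO_inv_log_one)
    isBigO_inv_log_one

lemma isBigO_mul_poissonLT_one {k : ℕ} (hk : 1 ≤ k) (β : ℝ) :
    (fun t : ℝ => t * poissonLT k (criticalMean k β t)) =O[atTop] fun _ => (1 : ℝ) := by
  have h0 : (fun t : ℝ => (Real.log t)⁻¹) =O[atTop] fun _ => (1 : ℝ) :=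
    (tendsto_inv_atTop_zero.comp Real.tendsto_log_atTop).isBigO_one ℝ
  exact (((isBigO_mul_poissonLT hk β).trans h0).add (isBigO_meanApprox k β)).congr_left
    fun t => by ring

/-- The binomial analogue of `isBigO_mul_poissonLT`. -/
lemma isBigO_mul_binomialMean {k : ℕ} (hk : 1 ≤ k) (β : ℝ) :
    (fun n : ℕ => n * binomialMean (criticalMean k β n / n) n (ltInd k) - meanApprox k β n)
      =O[atTop] fun n : ℕ => (Real.log n)⁻¹ := by
  have hcast := tendsto_natCast_atTop_atTop (R := ℝ)
  have hpos : ∀ᶠ n : ℕ in atTop, 0 < criticalMean k β n :=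
    ((tendsto_criticalMean k β).comp hcast).eventually_gt_atTop 0
  set w : ℕ → ℕ → ℝ := fun a n =>
    n * (Real.exp (-criticalMean k β n) * (criticalMean k β n ^ a / (a.factorial : ℝ))) with hw
  set ρ : ℕ → ℕ → ℝ := fun a n => (n.descFactorial a : ℝ) / (n : ℝ) ^ a *
      ((1 - criticalMean k β n / n) ^ n * Real.exp (criticalMean k β n) *
        (1 - criticalMean k β n / n)⁻¹ ^ a) with hρ
  have hw1 : ∀ a ∈ Finset.range k, w a =O[atTop] fun _ => (1 : ℝ) := by
    intro a ha
    refine IsBigO.trans (IsBigO.of_bound 1 ?_) ((isBigO_mul_poissonLT_one hk β).comp_tendsto hcast)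
    filter_upwards [hpos] with n hn
    simp only [hw, Function.comp_apply, poissonLT]
    rw [Real.norm_of_nonneg (by positivity), Real.norm_of_nonneg (by positivity), one_mul]
    gcongr
    exact Finset.single_le_sum (f := fun a => criticalMean k β n ^ a / (a.factorial : ℝ))
      (fun _ _ => by positivity) ha
  have hdiff : (fun n : ℕ => ∑ a ∈ Finset.range k, w a n * (ρ a n - 1)) =O[atTop]
      fun n : ℕ => (Real.log n)⁻¹ :=
    IsBigO.fun_sum fun a ha => by
      simpa only [one_mul] using (hw1 a ha).mul (isBigO_binomial_div_poisson k β a)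
  have hq1 : ∀ᶠ n : ℕ in atTop, criticalMean k β n / n < 1 := by
    have : Tendsto (fun t : ℝ => criticalMean k β t ^ 1 / t) atTop (𝓝 0) :=
      (isBigO_criticalMean_pow_div k β 1).trans_tendsto
        (tendsto_inv_atTop_zero.comp Real.tendsto_log_atTop)
    simpa using (this.comp hcast).eventually_lt_const one_pos
  refine (hdiff.add ((isBigO_mul_poissonLT hk β).comp_tendsto hcast)).congr' ?_ EventuallyEq.rfl
  filter_upwards [hq1, eventually_ge_atTop k, eventually_gt_atTop 0] with n hq hnk hn
  rw [binomialMean_ltInd hnk]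
  simp only [Function.comp_apply, poissonLT]
  rw [Finset.mul_sum, Finset.mul_sum, Finset.mul_sum, ← add_sub_assoc, ← Finset.sum_add_distrib]
  congr 1
  refine Finset.sum_congr rfl fun a ha => ?_
  have hle : a ≤ n := (Finset.mem_range.1 ha).le.trans hnk
  have hn' : (n : ℝ) ≠ 0 := by positivity
  have hne : 1 - criticalMean k β n / n ≠ 0 := by linarith
  have hch : (n.descFactorial a : ℝ) = a.factorial * n.choose a := by
    exact_mod_cast Nat.descFactorial_eq_factorial_mul_choose n a
  have hexp : Real.exp (-criticalMean k β n) * Real.exp (criticalMean k β n) = 1 := by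
    rw [← Real.exp_add]; simp
  have hpow : (1 - criticalMean k β n / n) ^ n * (1 - criticalMean k β n / n)⁻¹ ^ a
      = (1 - criticalMean k β n / n) ^ (n - a) := by
    rw [pow_sub₀ _ hne hle, inv_pow]
  have hf : (a.factorial : ℝ) ≠ 0 := by positivity
  simp only [hw, hρ, hch]
  calc _ = n * (criticalMean k β n ^ a / (n : ℝ) ^ a * n.choose a *
        (Real.exp (-criticalMean k β n) * Real.exp (criticalMean k β n)) *
        ((1 - criticalMean k β n / n) ^ n * (1 - criticalMean k β n / n)⁻¹ ^ a)) := by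
        field_simp
        ring
    _ = _ := by
        rw [hexp, hpow, div_pow]
        ring

end TwoSample

namespace TwoSample

section Exponential

lemma exp_neg_sub_nonneg (a w : ℝ) :
    0 ≤ Real.exp (-w) - Real.exp (-a) + Real.exp (-a) * (w - a) := by
  have h := mul_le_mul_of_nonneg_left (Real.add_one_le_exp (a - w)) (Real.exp_pos (-a)).le
  rw [← Real.exp_add, show -a + (a - w) = -w by ring] at h
  linarith

lemma exp_neg_sub_le_sq {a w : ℝ} (ha : 0 ≤ a) (hw : 0 ≤ w) :
    Real.exp (-w) - Real.exp (-a) + Real.exp (-a) * (w - a) ≤ (w - a) ^ 2 := by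
  have h1 : Real.exp (-a) ≤ 1 := Real.exp_le_one_iff.2 (by linarith)
  have h2 : Real.exp (-w) ≤ 1 := Real.exp_le_one_iff.2 (by linarith)
  have h3 := mul_le_mul_of_nonneg_left (Real.add_one_le_exp (w - a)) (Real.exp_pos (-w)).le
  rw [← Real.exp_add, show -w + (w - a) = -a by ring] at h3
  have h4 := exp_neg_sub_nonneg a w
  rcases le_total a w with h | h
  · nlinarith [mul_nonneg (sub_nonneg.2 h) (sub_nonneg.2 h2)]
  · nlinarith [mul_nonneg (sub_nonneg.2 h) (sub_nonneg.2 h2)]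

lemma abs_one_sub_pow_sub_exp_le {v : ℝ} (h0 : 0 ≤ v) (h1 : v ≤ 1) (m : ℕ) :
    |(1 - v) ^ m - Real.exp (-(m * v))| ≤ m * v ^ 2 := by
  have h := abs_one_sub_pow_mul_exp_sub_one_le h0 h1 m
  have he : Real.exp (-(m * v)) ≤ 1 := Real.exp_le_one_iff.2 (by
    have : 0 ≤ (m : ℝ) * v := by positivity
    linarith)
  have hmul : Real.exp (m * v) * Real.exp (-(m * v)) = 1 := by rw [← Real.exp_add]; simp
  have e : (1 - v) ^ m - Real.exp (-(m * v)) =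
      ((1 - v) ^ m * Real.exp (m * v) - 1) * Real.exp (-(m * v)) := by
    linear_combination -(1 - v) ^ m * hmul
  rw [e, abs_mul, abs_of_pos (Real.exp_pos _)]
  exact (mul_le_of_le_one_right (abs_nonneg _) he).trans h

variable {α : Type*} [MeasurableSpace α] {Q : Measure α} [IsProbabilityMeasure Q] {V : α → ℝ}

lemma integrable_of_unit_range {f : α → ℝ} (hf : Measurable f) (h0 : ∀ a, 0 ≤ f a)
    (h1 : ∀ a, f a ≤ 1) : Integrable f Q :=
  Integrable.of_bound (C := 1) hf.aestronglyMeasurable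
    (ae_of_all _ fun a => by rw [Real.norm_of_nonneg (h0 a)]; exact h1 a)

lemma abs_integral_exp_neg_sub_le (hV : Measurable V) (h0 : ∀ a, 0 ≤ V a) (h1 : ∀ a, V a ≤ 1)
    {p G u : ℝ} (hu : 0 ≤ u) (hp : ∫ a, V a ∂Q = p) (hG : ∫ a, V a ^ 2 ∂Q ≤ p ^ 2 + G) :
    |∫ a, Real.exp (-(u * V a)) ∂Q - Real.exp (-(u * p))| ≤ u ^ 2 * G := by
  have hp0 : 0 ≤ p := hp ▸ integral_nonneg h0
  have i1 : Integrable V Q := integrable_of_unit_range hV h0 h1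
  have i2 : Integrable (fun a => V a ^ 2) Q :=
    integrable_of_unit_range (hV.pow_const 2) (fun a => sq_nonneg _)
      fun a => pow_le_one₀ (h0 a) (h1 a)
  have i3 : Integrable (fun a => Real.exp (-(u * V a))) Q :=
    integrable_of_unit_range (by fun_prop) (fun a => (Real.exp_pos _).le) fun a =>
      Real.exp_le_one_iff.2 (neg_nonpos.2 (mul_nonneg hu (h0 a)))
  have i4 : Integrable (fun a => Real.exp (-(u * p)) * (u * V a - u * p)) Q :=
    ((i1.const_mul u).sub (integrable_const _)).const_mul _
  have i34 : Integrable (fun a => Real.exp (-(u * V a)) - Real.exp (-(u * p))) Q :=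
    i3.sub (integrable_const _)
  have i6 : Integrable (fun a => 2 * u ^ 2 * p * V a - u ^ 2 * p ^ 2) Q :=
    (i1.const_mul _).sub (integrable_const _)
  have e1 : ∫ a, (Real.exp (-(u * V a)) - Real.exp (-(u * p))
      + Real.exp (-(u * p)) * (u * V a - u * p)) ∂Q =
      ∫ a, Real.exp (-(u * V a)) ∂Q - Real.exp (-(u * p)) := by
    rw [integral_add i34 i4, integral_sub i3 (integrable_const _),
      integral_const_mul, integral_sub (i1.const_mul u) (integrable_const _), integral_const_mul, hp]
    simp
  have e2 : ∫ a, (u * V a - u * p) ^ 2 ∂Q = u ^ 2 * (∫ a, V a ^ 2 ∂Q - p ^ 2) := by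
    have : ∀ a, (u * V a - u * p) ^ 2 = u ^ 2 * V a ^ 2 - (2 * u ^ 2 * p * V a - u ^ 2 * p ^ 2) :=
      fun a => by ring
    simp_rw [this]
    rw [integral_sub (i2.const_mul _) i6,
      integral_sub (i1.const_mul _) (integrable_const _), integral_const_mul, integral_const_mul, hp]
    simp
    ring
  have i5 : Integrable (fun a => (u * V a - u * p) ^ 2) Q := by
    have : (fun a => (u * V a - u * p) ^ 2) =
      fun a => u ^ 2 * V a ^ 2 - (2 * u ^ 2 * p * V a - u ^ 2 * p ^ 2) := by ext a; ring
    rw [this]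
    exact (i2.const_mul _).sub i6
  rw [← e1, abs_of_nonneg (integral_nonneg fun a => exp_neg_sub_nonneg _ _)]
  calc _ ≤ ∫ a, (u * V a - u * p) ^ 2 ∂Q :=
        integral_mono (i34.add i4) i5 fun a =>
          exp_neg_sub_le_sq (mul_nonneg hu hp0) (mul_nonneg hu (h0 a))
    _ ≤ u ^ 2 * G := by rw [e2]; gcongr; linarith

lemma abs_integral_pow_sub_le (hV : Measurable V) (h0 : ∀ a, 0 ≤ V a) (h1 : ∀ a, V a ≤ 1)
    {p G : ℝ} (m : ℕ) (hp : ∫ a, V a ∂Q = p) (hG : ∫ a, V a ^ 2 ∂Q ≤ p ^ 2 + G) :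
    |∫ a, (1 - V a) ^ m ∂Q - Real.exp (-(m * p))| ≤ m * (p ^ 2 + G) + (m : ℝ) ^ 2 * G := by
  have i2 : Integrable (fun a => V a ^ 2) Q :=
    integrable_of_unit_range (hV.pow_const 2) (fun a => sq_nonneg _)
      fun a => pow_le_one₀ (h0 a) (h1 a)
  have i3 : Integrable (fun a => Real.exp (-(m * V a))) Q :=
    integrable_of_unit_range (by fun_prop) (fun a => (Real.exp_pos _).le) fun a =>
      Real.exp_le_one_iff.2 (neg_nonpos.2 (mul_nonneg m.cast_nonneg (h0 a)))
  have i4 : Integrable (fun a => (1 - V a) ^ m) Q :=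
    integrable_of_unit_range (by fun_prop) (fun a => pow_nonneg (sub_nonneg.2 (h1 a)) m)
      fun a => pow_le_one₀ (sub_nonneg.2 (h1 a)) (by linarith [h0 a])
  have hA : |∫ a, (1 - V a) ^ m ∂Q - ∫ a, Real.exp (-(m * V a)) ∂Q| ≤ m * (p ^ 2 + G) := by
    rw [← integral_sub i4 i3]
    refine abs_integral_le_integral_abs.trans ?_
    calc _ ≤ ∫ a, m * V a ^ 2 ∂Q :=
          integral_mono (i4.sub i3).abs (i2.const_mul _) fun a =>
            abs_one_sub_pow_sub_exp_le (h0 a) (h1 a) m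
      _ ≤ _ := by rw [integral_const_mul]; gcongr
  have hB := abs_integral_exp_neg_sub_le hV h0 h1 (u := m) m.cast_nonneg hp hG
  calc _ ≤ _ := abs_sub_le _ (∫ a, Real.exp (-(m * V a)) ∂Q) _
    _ ≤ _ := add_le_add hA hB

lemma integral_pow_poissonMeasure (u : ℝ≥0) (v : ℝ) :
    ∫ m, (1 - v) ^ m ∂(poissonMeasure u) = Real.exp (-(u * v)) := by
  rw [integral_poissonMeasure]
  have : ∀ n : ℕ, (Real.exp (-(u : ℝ)) * (u : ℝ) ^ n / (n.factorial : ℝ)) • (1 - v) ^ n =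
      Real.exp (-(u : ℝ)) * ((u * (1 - v)) ^ n / (n.factorial : ℝ)) := fun n => by
    rw [mul_pow, smul_eq_mul]; ring
  simp_rw [this]
  rw [tsum_mul_left, tsum_pow_div_factorial, ← Real.exp_add]
  ring_nf

end Exponential

section PoissonSample

variable {E : Type*} [PseudoMetricSpace E] [MeasurableSpace E] [OpensMeasurableSpace E]
  [SecondCountableTopology E] {Ω : Type*} [MeasurableSpace Ω] {P : Measure Ω}
  [IsProbabilityMeasure P] {X Y : ℕ → Ω → E}

/-- Conditionally on the numbers of points and on the `X`-sample, the Poisson number of vacant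
`Y`-points is zero with probability `exp (-u * vacancy)`. -/
lemma measureReal_isCovered_poisson (hX : ∀ i, Measurable (X i)) (hY : ∀ i, Measurable (Y i))
    (h : iIndepFun (Sum.elim X Y) P) {μ : Measure E} (hμ : ∀ i, P.map (Y i) = μ)
    {N M : Ω → ℕ} (hN : Measurable N) (hM : Measurable M) {κ : Measure ℕ} [IsProbabilityMeasure κ]
    (hNκ : P.map N = κ) {u : ℝ≥0} (hMu : P.map M = poissonMeasure u)
    (hNind : IndepFun N (fun ω => ((X · ω), (Y · ω))) P)
    (hMind : IndepFun M (fun ω => (N ω, ((X · ω), (Y · ω)))) P) (k : ℕ) (r : ℝ) :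
    P.real {ω | IsCovered k r (N ω) (M ω) (X · ω) (Y · ω)} =
      ∫ x, Real.exp (-(u * vacancy μ k r x.1 (X · x.2))) ∂(κ.prod P) := by
  have : IsProbabilityMeasure μ := hμ 0 ▸ Measure.isProbabilityMeasure_map (hY 0).aemeasurable
  have hXm : Measurable fun ω => (X · ω) := measurable_pi_lambda _ hX
  have hYm : Measurable fun ω => (Y · ω) := measurable_pi_lambda _ hY
  have hXY : Measurable fun ω => ((X · ω), (Y · ω)) := hXm.prodMk hYm
  set L : Measure ((ℕ → E) × (ℕ → E)) := P.map fun ω => ((X · ω), (Y · ω)) with hL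
  have : IsProbabilityMeasure L := Measure.isProbabilityMeasure_map hXY.aemeasurable
  have hlaw : P.map (fun ω => (M ω, (N ω, ((X · ω), (Y · ω))))) =
      (poissonMeasure u).prod (κ.prod L) := by
    rw [(indepFun_iff_map_prod_eq_prod_map_map hM.aemeasurable (hN.prodMk hXY).aemeasurable).1
      hMind, (indepFun_iff_map_prod_eq_prod_map_map hN.aemeasurable hXY.aemeasurable).1 hNind,
      hMu, hNκ]
  set G : Set (ℕ × (ℕ × ((ℕ → E) × (ℕ → E)))) :=
    {z | IsCovered k r z.2.1 z.1 z.2.2.1 z.2.2.2} with hG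
  have hGn : ∀ m, MeasurableSet {z : ℕ × ((ℕ → E) × (ℕ → E)) |
      IsCovered k r z.1 m z.2.1 z.2.2} := fun m => by
    refine measurableSet_setOfPred.2 (measurable_from_prod_countable_right fun n => ?_)
    exact measurableSet_setOfPred.1 (measurableSet_isCovered k r n m)
  have hGm : MeasurableSet G := by
    refine measurableSet_setOfPred.2 (measurable_from_prod_countable_right fun m => ?_)
    exact measurableSet_setOfPred.1 (hGn m)
  have hV : Measurable fun x : ℕ × Ω => vacancy μ k r x.1 (X · x.2) := measurable_mixed_vacancy hX μ k r
  have hpow0 : ∀ (m : ℕ) (x : ℕ × Ω), 0 ≤ (1 - vacancy μ k r x.1 (X · x.2)) ^ m := fun m x =>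
    pow_nonneg (sub_nonneg.2 (vacancy_le_one _ _ _ _ _)) m
  have hpow1 : ∀ (m : ℕ) (x : ℕ × Ω), (1 - vacancy μ k r x.1 (X · x.2)) ^ m ≤ 1 := fun m x =>
    pow_le_one₀ (sub_nonneg.2 (vacancy_le_one _ _ _ _ _))
      (sub_le_self _ (vacancy_nonneg _ _ _ _ _))
  have hi : ∀ m : ℕ, Integrable (fun x : ℕ × Ω => (1 - vacancy μ k r x.1 (X · x.2)) ^ m)
      (κ.prod P) := fun m =>
    integrable_of_unit_range ((hV.const_sub 1).pow_const m) (hpow0 m) (hpow1 m)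
  have hii : Integrable (fun z : ℕ × (ℕ × Ω) => (1 - vacancy μ k r z.2.1 (X · z.2.2)) ^ z.1)
      ((poissonMeasure u).prod (κ.prod P)) := by
    refine integrable_of_unit_range ?_ (fun z => hpow0 z.1 z.2) (fun z => hpow1 z.1 z.2)
    exact measurable_from_prod_countable_right fun m => (hV.const_sub 1).pow_const m
  have hinner : ∀ m : ℕ, (κ.prod L).real {z | (m, z) ∈ G} =
      ∫ x, (1 - vacancy μ k r x.1 (X · x.2)) ^ m ∂(κ.prod P) := by
    intro m
    refine (measureReal_prod_eq_integral κ L (hGn m)).trans ?_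
    rw [integral_prod _ (hi m)]
    refine integral_congr_ae (ae_of_all _ fun n => ?_)
    dsimp only
    rw [← measureReal_isCovered hX hY h hμ k r n m, hL]
    exact map_measureReal_apply hXY (measurableSet_isCovered k r n m)
  have hpre : {ω | IsCovered k r (N ω) (M ω) (X · ω) (Y · ω)} =
      (fun ω => (M ω, (N ω, ((X · ω), (Y · ω))))) ⁻¹' G := rfl
  rw [hpre, ← map_measureReal_apply (hM.prodMk (hN.prodMk hXY)) hGm, hlaw,
    measureReal_prod_eq_integral _ _ hGm]
  simp_rw [hinner]
  rw [integral_integral_swap hii]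
  exact integral_congr_ae (ae_of_all _ fun x => integral_pow_poissonMeasure u _)

end PoissonSample

lemma poisson_map_eq {Ω : Type*} [MeasurableSpace Ω] {P : Measure Ω} {Z : ℝ≥0 → Ω → ℕ}
    (hZ : IsUnitRatePoissonProcess P Z) (t : ℝ≥0) : P.map (Z t) = poissonMeasure t := by
  have h := (hZ.poisson_increments 0 t zero_le).map_eq
  rw [tsub_zero] at h
  rw [← h]
  refine Measure.map_congr ?_
  filter_upwards [hZ.zero] with ω hω
  simp [hω]

section Threshold

variable {d : ℕ}

lemma coverageThreshold_le_iff (x y : ℕ → EuclideanSpace ℝ (Fin d)) (n m k : ℕ) {r : ℝ}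
    (hr : 0 < r) :
    coverageThreshold x y n m k ≤ ENNReal.ofReal r ↔ IsCovered k r n m x y := by
  constructor
  · intro h j hj
    have hev : ∀ᶠ s in 𝓝[>] r, ∀ i ∈ Finset.range n, dist (x i) (y j) ≤ s →
        dist (x i) (y j) ≤ r := by
      rw [eventually_all_finset]
      intro i _
      rcases le_or_gt (dist (x i) (y j)) r with h1 | h1
      · exact Eventually.of_forall fun _ _ => h1
      · filter_upwards [nhdsWithin_le_nhds (eventually_lt_nhds h1)] with s hs hs'
        exact absurd hs' (not_le.2 hs)
    obtain ⟨s, hs, hrs⟩ := (hev.and self_mem_nhdsWithin).exists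
    have hlt : coverageThreshold x y n m k < ENNReal.ofReal s :=
      h.trans_lt ((ENNReal.ofReal_lt_ofReal_iff (hr.trans hrs)).2 hrs)
    obtain ⟨_, ⟨s', ⟨-, hs'⟩, rfl⟩, hlt'⟩ := sInf_lt_iff.1 hlt
    have hle : s' ≤ s := (ENNReal.ofReal_lt_ofReal_iff (hr.trans hrs)).1 hlt' |>.le
    classical
    refine (hs' j hj).trans (Finset.card_le_card fun i hi => ?_)
    rw [Finset.mem_filter] at hi ⊢
    exact ⟨hi.1, hs i hi.1 (le_trans hi.2 hle)⟩
  · intro h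
    exact sInf_le ⟨r, ⟨hr, h⟩, rfl⟩

lemma unitBallVolume_pos (d : ℕ) : 0 < unitBallVolume d :=
  ENNReal.toReal_pos (Metric.measure_closedBall_pos _ _ one_pos).ne' measure_closedBall_lt_top.ne

lemma centred_le_iff (hd : d ≠ 0) {A : Set (EuclideanSpace ℝ (Fin d))} (hA : 0 < volume.real A)
    (k : ℕ) {β t r : ℝ} (ht : 0 < t) (hr : 0 < r) (h : t * ballProb A r = criticalMean k β t)
    (R : ℝ≥0∞) : centred A k t R ≤ (β : EReal) ↔ R ≤ ENNReal.ofReal r := by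
  have hc : 0 < t * unitBallVolume d * (1 / volume.real A) := by
    have := unitBallVolume_pos d
    positivity
  rcases eq_or_ne R ∞ with rfl | hR
  · have : centred A k t ∞ = ⊤ := by
      rw [centred, ← EReal.coe_ennreal_pow, ENNReal.top_pow hd, EReal.coe_ennreal_top,
        EReal.coe_mul_top_of_pos hc,
        EReal.top_sub_coe, EReal.top_sub_coe]
    simp [this]
  · lift R to ℝ≥0 using hR
    have : centred A k t R = ((t * unitBallVolume d * (1 / volume.real A) * (R : ℝ) ^ d
        - Real.log t - ((k : ℝ) - 1) * Real.log (Real.log t) : ℝ) : EReal) := by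
      rw [centred]
      norm_cast
    rw [this, EReal.coe_le_coe_iff, sub_sub, sub_le_iff_le_add]
    have e : β + (Real.log t + ((k : ℝ) - 1) * Real.log (Real.log t))
        = t * unitBallVolume d * (1 / volume.real A) * r ^ d := by
      rw [criticalMean, ballProb] at h
      rw [add_comm, ← h]; ring
    rw [e, mul_le_mul_iff_right₀ hc, pow_le_pow_iff_left₀ R.coe_nonneg hr.le hd,
      ENNReal.le_ofReal_iff_toReal_le ENNReal.coe_ne_top hr.le, ENNReal.coe_toReal]

end Threshold

end TwoSample

namespace TwoSample

section Limits

variable {ι : Type*} {l : Filter ι} {T σ u p prob : ι → ℝ} {k : ℕ} {β : ℝ}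

lemma abs_exp_neg_sub_exp_neg_le {a b : ℝ} (ha : 0 ≤ a) (hb : 0 ≤ b) :
    |Real.exp (-a) - Real.exp (-b)| ≤ |a - b| := by
  have key : ∀ {a b : ℝ}, 0 ≤ a → a ≤ b → |Real.exp (-a) - Real.exp (-b)| ≤ |a - b| := by
    intro a b ha hab
    have h1 : Real.exp (-b) ≤ Real.exp (-a) := Real.exp_le_exp.2 (by linarith)
    have h2 : Real.exp (-a) ≤ 1 := Real.exp_le_one_iff.2 (by linarith)
    have h3 := exp_neg_sub_nonneg a b
    rw [abs_of_nonneg (by linarith), abs_sub_comm, abs_of_nonneg (by linarith)]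
    nlinarith [mul_nonneg (sub_nonneg.2 hab) (sub_nonneg.2 h2)]
  rcases le_total a b with h | h
  · exact key ha h
  · rw [abs_sub_comm, abs_sub_comm a b]; exact key hb h

lemma isBigO_exp_neg_sub_mainTerm (hT : Tendsto T l atTop) (hσ : σ =O[l] fun _ => (1 : ℝ))
    (hσ0 : ∀ᶠ i in l, 0 ≤ σ i) (hu : ∀ᶠ i in l, u i = σ i * T i) (hp0 : ∀ᶠ i in l, 0 ≤ p i)
    (hTp : (fun i => T i * p i - meanApprox k β (T i)) =O[l] fun i => (Real.log (T i))⁻¹) :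
    (fun i => Real.exp (-(u i * p i)) - mainTerm k (σ i) β (T i)) =O[l]
      fun i => (Real.log (T i))⁻¹ := by
  have hM : ∀ᶠ i in l, 0 ≤ meanApprox k β (T i) := by
    have := ((tendsto_meanApprox k β).comp hT).eventually_const_lt
      (show (0 : ℝ) < Real.exp (-β) / (Nat.factorial (k - 1) : ℝ) by positivity)
    exact this.mono fun i hi => hi.le
  have h1 : (fun i => σ i * (T i * p i - meanApprox k β (T i))) =O[l]
      fun i => (Real.log (T i))⁻¹ := by simpa using hσ.mul hTp
  refine IsBigO.trans (IsBigO.of_bound 1 ?_) h1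
  filter_upwards [hσ0, hu, hp0, hM, hT.eventually_ge_atTop 0] with i h1 h2 h3 h4 h5
  rw [mainTerm_eq, Real.norm_eq_abs, Real.norm_eq_abs, one_mul, h2]
  refine (abs_exp_neg_sub_exp_neg_le (by positivity) (by positivity)).trans_eq ?_
  congr 1
  ring

lemma isBigO_sub_mainTerm {C : ℝ} (hT : Tendsto T l atTop)
    (hσ : σ =O[l] fun _ => (1 : ℝ))
    (hσ0 : ∀ᶠ i in l, 0 ≤ σ i) (hu : ∀ᶠ i in l, u i = σ i * T i) (hp0 : ∀ᶠ i in l, 0 ≤ p i)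
    (hTp : (fun i => T i * p i - meanApprox k β (T i)) =O[l] fun i => (Real.log (T i))⁻¹)
    (hprob : ∀ᶠ i in l, |prob i - Real.exp (-(u i * p i))| ≤
      u i * (p i ^ 2 + p i * (C / (T i * criticalMean k β (T i)))) +
        u i ^ 2 * (p i * (C / (T i * criticalMean k β (T i))))) :
    (fun i => prob i - mainTerm k (σ i) β (T i)) =O[l] fun i => (Real.log (T i))⁻¹ := by
  have hlog : (fun i => (Real.log (T i))⁻¹) =O[l] fun _ => (1 : ℝ) :=
    ((tendsto_inv_atTop_zero.comp Real.tendsto_log_atTop).comp hT).isBigO_one ℝ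
  have hs : (fun i => T i * p i) =O[l] fun _ => (1 : ℝ) :=
    ((hTp.trans hlog).add ((isBigO_meanApprox k β).comp_tendsto hT)).congr_left
      fun i => by simp
  have hl : (fun i => (criticalMean k β (T i))⁻¹) =O[l] fun i => (Real.log (T i))⁻¹ :=
    (isBigO_criticalMean_inv k β).comp_tendsto hT
  have hinv : (fun i => (T i)⁻¹) =O[l] fun i => (Real.log (T i))⁻¹ := by
    simpa [Function.comp_def] using (isBigO_criticalMean_pow_div k β 0).comp_tendsto hT
  have hone : (fun i => (T i)⁻¹) =O[l] fun _ => (1 : ℝ) := hinv.trans hlog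
  have e1 : (fun i => σ i * (T i * p i) ^ 2 * (T i)⁻¹) =O[l] fun i => (Real.log (T i))⁻¹ := by
    simpa using (hσ.mul (hs.pow 2)).mul hinv
  have e2 : (fun i => σ i * (T i * p i) * (T i)⁻¹ * (criticalMean k β (T i))⁻¹) =O[l]
      fun i => (Real.log (T i))⁻¹ := by
    simpa using ((hσ.mul hs).mul hone).mul hl
  have e3 : (fun i => σ i ^ 2 * (T i * p i) * (criticalMean k β (T i))⁻¹) =O[l]
      fun i => (Real.log (T i))⁻¹ := by
    simpa using ((hσ.pow 2).mul hs).mul hl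
  have herr : (fun i => prob i - Real.exp (-(u i * p i))) =O[l] fun i => (Real.log (T i))⁻¹ := by
    refine IsBigO.trans (IsBigO.of_bound 1 ?_)
      (e1.add ((e2.const_mul_left C).add (e3.const_mul_left C)))
    filter_upwards [hprob, hu, hT.eventually_gt_atTop 0] with i h1 h2 h3
    rw [one_mul, Real.norm_eq_abs]
    refine h1.trans ((le_of_eq ?_).trans (le_abs_self _))
    rw [h2]
    field_simp
    ring
  exact (herr.add (isBigO_exp_neg_sub_mainTerm hT hσ hσ0 hu hp0 hTp)).congr_left fun i => by ring

lemma gumbelCDF_log {τ : ℝ} (hτ : 0 < τ) (k : ℕ) (x : ℝ) :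
    gumbelCDF (Real.log (τ / (Nat.factorial (k - 1) : ℝ))) 1 x =
      Real.exp (-(τ * (Real.exp (-x) / (Nat.factorial (k - 1) : ℝ)))) := by
  rw [gumbelCDF, div_one, neg_sub, sub_eq_add_neg, Real.exp_add, Real.exp_log (by positivity)]
  congr 1
  ring

lemma tendsto_gumbelCDF_of_isBigO {τ : ℝ} (hτ : 0 < τ) (hT : Tendsto T l atTop)
    (hσ : Tendsto σ l (𝓝 τ))
    (h : (fun i => prob i - mainTerm k (σ i) β (T i)) =O[l] fun i => (Real.log (T i))⁻¹) :
    Tendsto prob l (𝓝 (gumbelCDF (Real.log (τ / (Nat.factorial (k - 1) : ℝ))) 1 β)) := by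
  have h0 : Tendsto (fun i => prob i - mainTerm k (σ i) β (T i)) l (𝓝 0) :=
    h.trans_tendsto ((tendsto_inv_atTop_zero.comp Real.tendsto_log_atTop).comp hT)
  have h1 : Tendsto (fun i => mainTerm k (σ i) β (T i)) l
      (𝓝 (gumbelCDF (Real.log (τ / (Nat.factorial (k - 1) : ℝ))) 1 β)) := by
    simp_rw [mainTerm_eq, gumbelCDF_log hτ]
    exact (Real.continuous_exp.tendsto _).comp
      (hσ.mul ((tendsto_meanApprox k β).comp hT)).neg
  simpa using h0.add h1

end Limits

section Radius

variable {d : ℕ} {A B : Set (EuclideanSpace ℝ (Fin d))}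

lemma exists_closedBall_subset (hA : IsCompact A) (hBA : closure B ⊆ interior A) :
    ∃ δ > 0, ∀ y ∈ B, ∀ r ≤ δ, Metric.closedBall y r ⊆ A := by
  have hB : IsCompact (closure B) :=
    hA.of_isClosed_subset isClosed_closure (hBA.trans interior_subset)
  obtain ⟨δ, hδ, h⟩ := hB.exists_cthickening_subset_open isOpen_interior hBA
  refine ⟨δ, hδ, fun y hy r hr => ?_⟩
  exact ((Metric.closedBall_subset_closedBall hr).trans
    (Metric.closedBall_subset_cthickening (subset_closure hy) δ)).trans (h.trans interior_subset)

/-- The radius of the balls which contain `criticalMean k β t` points on average. -/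
noncomputable def criticalRadius (A : Set (EuclideanSpace ℝ (Fin d))) (k : ℕ) (β t : ℝ) : ℝ :=
  (criticalMean k β t / t * (volume.real A / unitBallVolume d)) ^ ((d : ℝ)⁻¹)

lemma criticalRadius_pos (hA : 0 < volume.real A) {k : ℕ} {β t : ℝ} (ht : 0 < t)
    (hm : 0 < criticalMean k β t) : 0 < criticalRadius A k β t := by
  have := unitBallVolume_pos d
  exact Real.rpow_pos_of_pos (by positivity) _

lemma ballProb_criticalRadius (hd : d ≠ 0) (hA : 0 < volume.real A) {k : ℕ} {β t : ℝ} (ht : 0 < t)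
    (hm : 0 < criticalMean k β t) :
    ballProb A (criticalRadius A k β t) = criticalMean k β t / t := by
  have := unitBallVolume_pos d
  rw [ballProb, criticalRadius, Real.rpow_inv_natCast_pow (by positivity) hd]
  field_simp

lemma tendsto_criticalRadius (hd : d ≠ 0) (k : ℕ) (β : ℝ) :
    Tendsto (criticalRadius A k β) atTop (𝓝 0) := by
  have h1 : Tendsto (fun t => criticalMean k β t / t) atTop (𝓝 0) := by
    have := (isBigO_criticalMean_pow_div k β 1).trans_tendsto
      (tendsto_inv_atTop_zero.comp Real.tendsto_log_atTop)
    simpa using this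
  have h2 := (h1.mul_const (volume.real A / unitBallVolume d)).rpow_const
    (p := (d : ℝ)⁻¹) (Or.inr (by positivity))
  rwa [zero_mul, Real.zero_rpow (by positivity)] at h2

/-- The variance of the vacancy is of smaller order than its mean divided by the sample size. -/
lemma exists_vacancy_moment_bound {Ω : Type*} [MeasurableSpace Ω] {P : Measure Ω}
    [IsProbabilityMeasure P] {X : ℕ → Ω → EuclideanSpace ℝ (Fin d)} (hd : 2 ≤ d)
    (hA : IsCompact A) (hB : MeasurableSet B) (hBA : B ⊆ A) (hBpos : 0 < volume B)
    (hX : ∀ i, Measurable (X i)) (hi : iIndepFun X P) (hν : ∀ i, P.map (X i) = cond volume A)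
    (k : ℕ) :
    ∃ C : ℝ, 0 ≤ C ∧ ∀ (κ : Measure ℕ) [IsProbabilityMeasure κ] (t r : ℝ), 0 < t → 0 < r →
      IsCountLaw κ t k → (∀ y ∈ B, Metric.closedBall y r ⊆ A) → 1 ≤ t * ballProb A r →
      ∫ x, vacancy (cond volume B) k r x.1 (X · x.2) ∂(κ.prod P) = vacantProb κ k (ballProb A r) ∧
      ∫ x, vacancy (cond volume B) k r x.1 (X · x.2) ^ 2 ∂(κ.prod P) ≤
        vacantProb κ k (ballProb A r) ^ 2 +
          vacantProb κ k (ballProb A r) * (C / (t * (t * ballProb A r))) := by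
  have hθ := unitBallVolume_pos d
  have hAr : 0 < volume.real A :=
    ENNReal.toReal_pos (hBpos.trans_le (measure_mono hBA)).ne' hA.measure_lt_top.ne
  have hBr : 0 < volume.real B :=
    ENNReal.toReal_pos hBpos.ne' (measure_ne_top_of_subset hBA hA.measure_lt_top.ne)
  set I := ∫ x : EuclideanSpace ℝ (Fin d), Real.exp (-‖x‖)
  have hI : 0 ≤ I := integral_nonneg fun x => (Real.exp_pos _).le
  set C := 2 ^ k * I * 8 ^ d * volume.real A / (unitBallVolume d * volume.real B) with hC
  refine ⟨C, by positivity, ?_⟩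
  intro κ _ t r ht hr hκ hball hl
  obtain ⟨h1, h2⟩ := vacancy_moments hA hB hBpos hX hi hν ht hκ hr hball
  refine ⟨h1, h2.trans ?_⟩
  have hp0 : 0 ≤ vacantProb κ k (ballProb A r) :=
    h1 ▸ integral_nonneg fun x => vacancy_nonneg _ _ _ _ _
  gcongr
  have hq : ballProb A r = unitBallVolume d * r ^ d / volume.real A := rfl
  have hrd : r ^ d = t * ballProb A r * volume.real A / (t * unitBallVolume d) := by
    rw [hq]; field_simp
  set lam := t * ballProb A r with hlam
  have hl0 : 0 < lam := by linarith
  have hpow : lam ^ 2 ≤ lam ^ d := pow_le_pow_right₀ hl hd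
  clear_value lam
  have e : 2 ^ k * (I / (lam / (8 * r)) ^ d / volume.real B) = C / t * (lam / lam ^ d) := by
    rw [div_pow, mul_pow, hrd, hC]
    field_simp
  rw [e, show C / (t * lam) = C / t * (1 / lam) by field_simp]
  have : lam / lam ^ d ≤ 1 / lam := by
    rw [div_le_div_iff₀ (by positivity) hl0]
    linarith [hpow, sq lam]
  gcongr

end Radius

section Main

variable {d : ℕ} {Ω : Type*} [MeasurableSpace Ω] {P : Measure Ω} [IsProbabilityMeasure P]
  {A B : Set (EuclideanSpace ℝ (Fin d))} {X Y : ℕ → Ω → EuclideanSpace ℝ (Fin d)}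
  {Z Z' : ℝ≥0 → Ω → ℕ} {k : ℕ} {τ : ℝ}

/-- The quantities at the critical radius, for all large `t`. -/
lemma eventually_criticalRadius (hd : d ≠ 0) (hA : IsCompact A) (hBA : closure B ⊆ interior A)
    (hAr : 0 < volume.real A) (k : ℕ) (β : ℝ) :
    ∀ᶠ t : ℝ in atTop, 0 < t ∧ 1 ≤ criticalMean k β t ∧ 0 < criticalRadius A k β t ∧
      ballProb A (criticalRadius A k β t) = criticalMean k β t / t ∧
      (∀ y ∈ B, Metric.closedBall y (criticalRadius A k β t) ⊆ A) ∧
      ∀ R : ℝ≥0∞, centred A k t R ≤ (β : EReal) ↔ R ≤ ENNReal.ofReal (criticalRadius A k β t) := by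
  obtain ⟨δ, hδ, hball⟩ := exists_closedBall_subset hA hBA
  filter_upwards [eventually_gt_atTop 0, (tendsto_criticalMean k β).eventually_ge_atTop 1,
    (tendsto_criticalRadius (A := A) hd k β).eventually_lt_const hδ] with t ht hm hr
  have hm0 : 0 < criticalMean k β t := by linarith
  have hr0 := criticalRadius_pos hAr ht hm0
  have hq := ballProb_criticalRadius hd hAr ht hm0
  exact ⟨ht, hm, hr0, hq, fun y hy => hball y hy _ hr.le,
    centred_le_iff hd hAr k ht hr0 (by rw [hq]; field_simp)⟩

theorem binomial_isBigO (hd : 2 ≤ d) (hA : IsCompact A) (hB : MeasurableSet B)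
    (hBA : closure B ⊆ interior A) (hBpos : 0 < volume B) (hmodel : IsTwoSampleModel P A B X Y Z Z')
    (hk : 1 ≤ k) {m : ℕ → ℕ} (hm : Tendsto (fun n : ℕ => (m n : ℝ) / (n : ℝ)) atTop (𝓝 τ))
    (β : ℝ) :
    (fun n : ℕ => P.real {ω | centred A k n (binomialThreshold X Y n (m n) k ω) ≤ (β : EReal)}
      - mainTerm k ((m n : ℝ) / (n : ℝ)) β n) =O[atTop] (fun n : ℕ => (Real.log n)⁻¹) := by
  have hd0 : d ≠ 0 := by omega
  have hsub : B ⊆ A := subset_closure.trans (hBA.trans interior_subset)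
  have hBfin : volume B ≠ ∞ := measure_ne_top_of_subset hsub hA.measure_lt_top.ne
  have hAr : 0 < volume.real A :=
    ENNReal.toReal_pos (hBpos.trans_le (measure_mono hsub)).ne' hA.measure_lt_top.ne
  have : IsProbabilityMeasure (cond volume B) := cond_isProbabilityMeasure_of_finite hBpos.ne' hBfin
  have hXi : iIndepFun X P := hmodel.indep_samples.precomp (g := Sum.inl) Sum.inl_injective
  obtain ⟨C, hC, hmom⟩ := exists_vacancy_moment_bound hd hA hB hsub hBpos hmodel.measurable_X hXi
    hmodel.uniform_X k
  have hcast := tendsto_natCast_atTop_atTop (R := ℝ)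
  have hev := hcast.eventually (eventually_criticalRadius hd0 hA hBA hAr k β)
  have hmoments : ∀ᶠ n : ℕ in atTop,
      let r := criticalRadius A k β n
      let p := binomialMean (criticalMean k β n / n) n (ltInd k)
      ∫ x, vacancy (cond volume B) k r x.1 (X · x.2) ∂((Measure.dirac n).prod P) = p ∧
      ∫ x, vacancy (cond volume B) k r x.1 (X · x.2) ^ 2 ∂((Measure.dirac n).prod P) ≤
        p ^ 2 + p * (C / (n * criticalMean k β n)) := by
    filter_upwards [hev] with n ⟨hn, hl, hr, hq, hball, _⟩
    have hnl : (n : ℝ) * ballProb A (criticalRadius A k β n) = criticalMean k β n := by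
      rw [hq]; field_simp
    have := hmom (Measure.dirac n) n (criticalRadius A k β n) hn hr (isCountLaw_dirac n k) hball
      (by rw [hnl]; exact hl)
    rwa [hnl, vacantProb_dirac, hq] at this
  refine isBigO_sub_mainTerm (u := fun n => m n)
    (p := fun n : ℕ => binomialMean (criticalMean k β n / n) n (ltInd k)) (C := C) hcast
    (hm.isBigO_one ℝ) (Eventually.of_forall fun n => by positivity) ?_ ?_
    (isBigO_mul_binomialMean hk β) ?_
  · filter_upwards [eventually_gt_atTop 0] with n hn
    have : (n : ℝ) ≠ 0 := by positivity
    field_simp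
  · filter_upwards [hmoments] with n hn
    rw [← hn.1]
    exact integral_nonneg fun x => vacancy_nonneg _ _ _ _ _
  · filter_upwards [hev, hmoments] with n ⟨hn, hl, hr, hq, hball, hcen⟩ ⟨h1, h2⟩
    have hset : {ω | centred A k n (binomialThreshold X Y n (m n) k ω) ≤ (β : EReal)} =
        {ω | IsCovered k (criticalRadius A k β n) n (m n) (X · ω) (Y · ω)} := by
      ext ω
      exact (hcen _).trans (coverageThreshold_le_iff _ _ _ _ _ hr)
    have hV := measurable_mixed_vacancy hmodel.measurable_X (cond volume B) k
      (criticalRadius A k β n)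
    rw [hset, measureReal_isCovered hmodel.measurable_X hmodel.measurable_Y hmodel.indep_samples
      hmodel.uniform_Y]
    have hdir : ∫ x, (1 - vacancy (cond volume B) k (criticalRadius A k β n) x.1 (X · x.2)) ^ m n
        ∂((Measure.dirac n).prod P) =
        ∫ ω, (1 - vacancy (cond volume B) k (criticalRadius A k β n) n (X · ω)) ^ m n ∂P := by
      rw [Measure.dirac_prod, integral_map (by fun_prop)
        ((hV.const_sub 1).pow_const _).aestronglyMeasurable]
    rw [← hdir]
    exact abs_integral_pow_sub_le hV (fun _ => vacancy_nonneg _ _ _ _ _)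
      (fun _ => vacancy_le_one _ _ _ _ _) (m n) h1 h2

theorem poisson_isBigO (hd : 2 ≤ d) (hA : IsCompact A) (hB : MeasurableSet B)
    (hBA : closure B ⊆ interior A) (hBpos : 0 < volume B) (hmodel : IsTwoSampleModel P A B X Y Z Z')
    (hk : 1 ≤ k) (hτ : 0 < τ) (β : ℝ) :
    (fun t : ℝ => P.real {ω | centred A k t
        (poissonThreshold X Y Z Z' t.toNNReal (τ * t).toNNReal k ω) ≤ (β : EReal)}
      - mainTerm k τ β t) =O[atTop] (fun t : ℝ => (Real.log t)⁻¹) := by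
  have hd0 : d ≠ 0 := by omega
  have hsub : B ⊆ A := subset_closure.trans (hBA.trans interior_subset)
  have hBfin : volume B ≠ ∞ := measure_ne_top_of_subset hsub hA.measure_lt_top.ne
  have hAr : 0 < volume.real A :=
    ENNReal.toReal_pos (hBpos.trans_le (measure_mono hsub)).ne' hA.measure_lt_top.ne
  have : IsProbabilityMeasure (cond volume B) := cond_isProbabilityMeasure_of_finite hBpos.ne' hBfin
  have hXi : iIndepFun X P := hmodel.indep_samples.precomp (g := Sum.inl) Sum.inl_injective
  obtain ⟨C, hC, hmom⟩ := exists_vacancy_moment_bound hd hA hB hsub hBpos hmodel.measurable_X hXi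
    hmodel.uniform_X k
  have hev := eventually_criticalRadius hd0 hA hBA hAr k β
  have hmoments : ∀ᶠ t : ℝ in atTop,
      let r := criticalRadius A k β t
      let p := poissonLT k (criticalMean k β t)
      ∫ x, vacancy (cond volume B) k r x.1 (X · x.2) ∂((poissonMeasure t.toNNReal).prod P) = p ∧
      ∫ x, vacancy (cond volume B) k r x.1 (X · x.2) ^ 2 ∂((poissonMeasure t.toNNReal).prod P) ≤
        p ^ 2 + p * (C / (t * criticalMean k β t)) := by
    filter_upwards [hev] with t ⟨ht, hl, hr, hq, hball, _⟩
    have htl : t * ballProb A (criticalRadius A k β t) = criticalMean k β t := by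
      rw [hq]; field_simp
    have htc : (t.toNNReal : ℝ) = t := Real.coe_toNNReal t ht.le
    have hlaw := isCountLaw_poisson t.toNNReal k
    rw [htc] at hlaw
    have := hmom (poissonMeasure t.toNNReal) t (criticalRadius A k β t) ht hr hlaw hball
      (by rw [htl]; exact hl)
    rwa [vacantProb_poisson, htc, htl] at this
  refine isBigO_sub_mainTerm (T := fun t => t) (σ := fun _ => τ) (u := fun t => τ * t)
    (p := fun t : ℝ => poissonLT k (criticalMean k β t)) (C := C) tendsto_id
    (isBigO_const_const _ one_ne_zero _) (Eventually.of_forall fun _ => hτ.le)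
    (Eventually.of_forall fun _ => rfl) ?_ (isBigO_mul_poissonLT hk β) ?_
  · filter_upwards [hmoments] with t ht
    rw [← ht.1]
    exact integral_nonneg fun x => vacancy_nonneg _ _ _ _ _
  · filter_upwards [hev, hmoments] with t ⟨ht, hl, hr, hq, hball, hcen⟩ ⟨h1, h2⟩
    have hset : {ω | centred A k t
        (poissonThreshold X Y Z Z' t.toNNReal (τ * t).toNNReal k ω) ≤ (β : EReal)} =
        {ω | IsCovered k (criticalRadius A k β t) (Z t.toNNReal ω) (Z' (τ * t).toNNReal ω)
          (X · ω) (Y · ω)} := by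
      ext ω
      exact (hcen _).trans (coverageThreshold_le_iff _ _ _ _ _ hr)
    have hV := measurable_mixed_vacancy hmodel.measurable_X (cond volume B) k
      (criticalRadius A k β t)
    have hswap : Measurable fun f : ℕ → EuclideanSpace ℝ (Fin d) × EuclideanSpace ℝ (Fin d) =>
        ((fun i => (f i).1), (fun i => (f i).2)) := by fun_prop
    have hNind : IndepFun (Z t.toNNReal) (fun ω => ((X · ω), (Y · ω))) P :=
      hmodel.indep_Z.comp (measurable_pi_apply t.toNNReal) hswap
    have hMind : IndepFun (Z' (τ * t).toNNReal)
        (fun ω => (Z t.toNNReal ω, ((X · ω), (Y · ω)))) P :=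
      hmodel.indep_Z'.comp (measurable_pi_apply (τ * t).toNNReal)
        (((measurable_pi_apply t.toNNReal).comp measurable_snd).prodMk
          (hswap.comp measurable_fst))
    have hτt : 0 ≤ τ * t := by positivity
    rw [hset, measureReal_isCovered_poisson hmodel.measurable_X hmodel.measurable_Y
      hmodel.indep_samples hmodel.uniform_Y (hmodel.poisson_Z.measurable _)
      (hmodel.poisson_Z'.measurable _) (poisson_map_eq hmodel.poisson_Z _)
      (poisson_map_eq hmodel.poisson_Z' _) hNind hMind, Real.coe_toNNReal _ hτt]
    refine (abs_integral_exp_neg_sub_le hV (fun _ => vacancy_nonneg _ _ _ _ _)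
      (fun _ => vacancy_le_one _ _ _ _ _) hτt h1 h2).trans ?_
    have hp0 : 0 ≤ poissonLT k (criticalMean k β t) :=
      h1 ▸ integral_nonneg fun x => vacancy_nonneg _ _ _ _ _
    have hl0 : 0 < criticalMean k β t := by linarith
    exact le_add_of_nonneg_left (by positivity)

end Main

end TwoSample
theorem theorem2p1 {d : ℕ} (hd : 2 ≤ d)
    {Ω : Type*} [MeasurableSpace Ω] (P : Measure Ω) [IsProbabilityMeasure P]
    (A B : Set (EuclideanSpace ℝ (Fin d)))
    (hA : IsCompact A) (hB : MeasurableSet B) (hBA : closure B ⊆ interior A)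
    (hBR : TwoSample.IsRiemannMeasurable B) (hBpos : 0 < volume B)
    (X Y : ℕ → Ω → EuclideanSpace ℝ (Fin d)) (Z Z' : ℝ≥0 → Ω → ℕ)
    (hmodel : TwoSample.IsTwoSampleModel P A B X Y Z Z')
    (k : ℕ) (hk : 1 ≤ k) (τ : ℝ) (hτ : 0 < τ) :
    (∀ m : ℕ → ℕ, Tendsto (fun n : ℕ => (m n : ℝ) / (n : ℝ)) atTop (𝓝 τ) →
      (∀ β : ℝ,
        (fun n : ℕ =>
          P.real {ω | TwoSample.centred A k n (TwoSample.binomialThreshold X Y n (m n) k ω)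
            ≤ (β : EReal)}
          - TwoSample.mainTerm k ((m n : ℝ) / (n : ℝ)) β n)
        =O[atTop] (fun n : ℕ => (Real.log n)⁻¹)) ∧
      TwoSample.TendstoInLaw P
        (fun (n : ℕ) ω => TwoSample.centred A k n (TwoSample.binomialThreshold X Y n (m n) k ω))
        atTop (TwoSample.gumbelCDF (Real.log (τ / (Nat.factorial (k - 1) : ℝ))) 1)) ∧
    (∀ β : ℝ,
      (fun t : ℝ =>
        P.real {ω | TwoSample.centred A k t
            (TwoSample.poissonThreshold X Y Z Z' t.toNNReal (τ * t).toNNReal k ω)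
          ≤ (β : EReal)}
        - TwoSample.mainTerm k τ β t)
      =O[atTop] (fun t : ℝ => (Real.log t)⁻¹)) ∧
    TwoSample.TendstoInLaw P
      (fun (t : ℝ) ω => TwoSample.centred A k t
        (TwoSample.poissonThreshold X Y Z Z' t.toNNReal (τ * t).toNNReal k ω))
      atTop (TwoSample.gumbelCDF (Real.log (τ / (Nat.factorial (k - 1) : ℝ))) 1) := by
  refine ⟨fun m hm => ⟨TwoSample.binomial_isBigO hd hA hB hBA hBpos hmodel hk hm, fun x _ => ?_⟩,
    TwoSample.poisson_isBigO hd hA hB hBA hBpos hmodel hk hτ, fun x _ => ?_⟩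
  · exact TwoSample.tendsto_gumbelCDF_of_isBigO hτ tendsto_natCast_atTop_atTop hm
      (TwoSample.binomial_isBigO hd hA hB hBA hBpos hmodel hk hm x)
  · exact TwoSample.tendsto_gumbelCDF_of_isBigO (T := fun t => t) (σ := fun _ => τ) hτ tendsto_id
      tendsto_const_nhds (TwoSample.poisson_isBigO hd hA hB hBA hBpos hmodel hk hτ x)
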